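/- Let $(A,\mathfrak m)$ be a regular local ring of characteristic $p>0$ that is $F$-finite (the Frobenius $F\colon A\to A$ is finite), and let $0\neq f\in A$. **Non-splitting index.** For a $\mathbb Q$-divisor $E$ on $\operatorname{Spec}A$ put $A(E)=\{a\in\operatorname{Frac}A : a=0 \text{ or } \operatorname{div}(a)+E\ge 0\}$ and $W_n(A)(E)=\{(a_0,\dots,a_{n-1})\in W_n(\operatorname{Frac}A) : a_i\in A(p^iE)\text{ for all } i\}$. For an effective $\mathbb Q$-divisor $D$ and $n\ge 1$, let $Q_{D,n}$ be the pushout, in the category of $W_n(A)$-modules, of $W_n(A)\xrightarrow{F}F_*W_n(A)\hookrightarrow F_*W_n(A)(pD)$ and the restriction $W_n(A)\to A$. The pair $(A,D)$ is *$n$-quasi-$F$-split* if the evaluation map $\operatorname{Hom}_{W_n(A)}(Q_{D,n},A)\to A$ at the image of $1\in A$ is surjective. Put $$\mathrm{ns}(f)=\inf\Bigl\{n\ge 1 : \bigl(A,(1-\tfrac{2}{p^n})\operatorname{div}(f)\bigr)\text{ is not } n\text{-quasi-}F\text{-split}\Bigr\},\qquad \inf\emptyset=\infty .$$ **The ideals.**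 Let $u$ be a generator of $\operatorname{Hom}_A(F_*A,A)$ as an $F_*A$-module. Let $x_1,\dots,x_d$ be a $p$-basis of $A$, that is, every $a\in A$ is uniquely of the form $a=\sum_{0\le e_i<p}c_e^p\,x^e$ with $c_e\in A$, and let $\Delta\colon A\to A/F(A)$ be the map given by $[a]=\sum_e[c_e^p x^e]+(0,\Delta(a))$ in $W_2(A)$, where $[\,\cdot\,]$ denotes the Teichmüller representative. Define the $A$-linear map $$\theta_f\colon\operatorname{Ker}(u)\to A,\qquad \theta_f(F_*a)=f^{p-2}\,u(F_*(\Delta(f)a)),$$ and ideals of $A$ by $$I^{\mathrm{ns}}_1(f)=f^{p-2}A,\qquad I^{\mathrm{ns}}_{n+1}(f)=\theta_f\bigl(F_*I^{\mathrm{ns}}_n(f)\cap\operatorname{Ker}(u)\bigr)+f^{p-1}A\quad(n\ge 1).$$ **Theorem.** With $\mathfrak m^{[p]}$ the ideal generated by the $p$-th powers of the elements of $\mathfrak m$, $$\mathrm{ns}(f)=\inf\{n\ge 1 : I^{\mathrm{ns}}_n(f)\subseteq\mathfrak m^{[p]}\},$$ where the right-hand side is $\infty$ if the set is empty. -/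

import Mathlib

noncomputable section

namespace QuasiFSplit

/-! ### Restriction of scalars and Witt vectors of finite length -/

/-- The module `M` over `S`, regarded as a module over `R` through `φ : R →+* S`. For `φ` a
Frobenius map this is the module usually written `F_* M`. -/
def Along {R S : Type*} [CommRing R] [CommRing S] (_ : R →+* S) (M : Type*) : Type _ := M

namespace Along

variable {R S M : Type*} [CommRing R] [CommRing S] (φ : R →+* S) [AddCommGroup M] [Module S M]

instance : AddCommGroup (Along φ M) := inferInstanceAs (AddCommGroup M)

instance : Module R (Along φ M) := Module.compHom M φ

/-- The identity map `m ↦ F_* m`. -/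
def of : M ≃+ Along φ M := AddEquiv.refl M

theorem smul_of (r : R) (m : M) : r • of φ m = of φ (φ r • m) := rfl

end Along

section Witt

variable (p : ℕ) [Fact p.Prime] (n : ℕ)

/-- `W_n(A)`. -/
abbrev W (A : Type*) : Type _ := TruncatedWittVector p n A

/-- The ring homomorphism `W_n(A) → W_n(B)`, `(a_0, …, a_{n-1}) ↦ (φ a_0, …, φ a_{n-1})`. -/
def wittMap {A B : Type*} [CommRing A] [CommRing B] (φ : A →+* B) : W p n A →+* W p n B :=
  RingHom.liftOfRightInverse (WittVector.truncate n) TruncatedWittVector.out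
    TruncatedWittVector.truncateFun_out
    ⟨(WittVector.truncate n).comp (WittVector.map φ), by
      intro x hx
      have hx' := (WittVector.mem_ker_truncate n x).1 hx
      change WittVector.map φ x ∈ RingHom.ker (WittVector.truncate n)
      rw [WittVector.mem_ker_truncate]
      intro i hi
      rw [WittVector.map_coeff, hx' i hi, map_zero]⟩

theorem coeff_wittMap {A B : Type*} [CommRing A] [CommRing B] (φ : A →+* B) (w : W p n A)
    (i : Fin n) : (wittMap p n φ w).coeff i = φ (w.coeff i) := by
  obtain ⟨y, rfl⟩ := WittVector.truncate_surjective p n A w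
  have h : wittMap p n φ (WittVector.truncate n y) =
      WittVector.truncate n (WittVector.map φ y) :=
    RingHom.liftOfRightInverse_comp_apply _ _ _ _ y
  rw [h, WittVector.coeff_truncate, WittVector.coeff_truncate, WittVector.map_coeff]

/-- The restriction `Res : W_n(A) → A`, `(a_0, …, a_{n-1}) ↦ a_0`. -/
def res [NeZero n] (A : Type*) [CommRing A] : W p n A →+* A :=
  RingHom.liftOfRightInverse (WittVector.truncate n) TruncatedWittVector.out
    TruncatedWittVector.truncateFun_out
    ⟨WittVector.constantCoeff, by
      intro x hx
      exact (WittVector.mem_ker_truncate n x).1 hx 0 (Nat.pos_of_neZero n)⟩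

theorem res_apply [NeZero n] {A : Type*} [CommRing A] (w : W p n A) :
    res p n A w = w.coeff ⟨0, Nat.pos_of_neZero n⟩ := by
  obtain ⟨y, rfl⟩ := WittVector.truncate_surjective p n A w
  have h : res p n A (WittVector.truncate n y) = WittVector.constantCoeff y :=
    RingHom.liftOfRightInverse_comp_apply _ _ _ _ y
  rw [h, WittVector.coeff_truncate]
  rfl

end Witt

/-! ### Divisors -/

section Divisors

variable {A : Type*} [CommRing A]

/-- The prime divisors of `Spec A`, that is, the primes of height one. -/
def PrimeDivisor (A : Type*) [CommRing A] : Type _ :=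
  {P : PrimeSpectrum A // P.asIdeal.height = 1}

/-- The order of vanishing of `a ∈ A` along `P`: the length of `A_P / a A_P`. When `A_P` is a
discrete valuation ring this is the normalized valuation of `a`, for `a ≠ 0`. -/
def ordAt (P : PrimeDivisor A) (a : A) : ℤ :=
  ((Ring.ord (Localization.AtPrime P.1.asIdeal) (algebraMap A _ a)).toNat : ℤ)

/-- The order along `P` of an element of the fraction field: numerator minus denominator. The
value at `0` is meaningless. -/
def ordFracAt (P : PrimeDivisor A) (a : FractionRing A) : ℤ :=
  ordAt P (IsLocalization.sec (nonZeroDivisors A) a).1 -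
    ordAt P ((IsLocalization.sec (nonZeroDivisors A) a).2 : A)

/-- `ℚ`-divisors on `Spec A`, as families of coefficients. -/
abbrev QDivisor (A : Type*) [CommRing A] : Type _ := PrimeDivisor A → ℚ

/-- The principal divisor `div(f)`, for `f` a nonzero element of `A`. -/
def principalDivisor (f : A) : QDivisor A := fun P => (ordAt P f : ℚ)

/-- `A(E) = {a ∈ Frac A | a = 0 or div(a) + E ≥ 0}`. -/
def sections (E : QDivisor A) : Set (FractionRing A) :=
  {a | a = 0 ∨ ∀ P : PrimeDivisor A, 0 ≤ (ordFracAt P a : ℚ) + E P}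

theorem ordFracAt_one (P : PrimeDivisor A) : ordFracAt P (1 : FractionRing A) = 0 := by
  have h := IsLocalization.sec_spec (nonZeroDivisors A) (1 : FractionRing A)
  rw [one_mul] at h
  have h' := IsFractionRing.injective A (FractionRing A) h
  rw [ordFracAt, ← h', sub_self]

end Divisors

/-! ### Quasi-`F`-splitting of pairs -/

section Pairs

variable (p : ℕ) [Fact p.Prime] (n : ℕ) (A : Type*) [CommRing A] [CharP A p]

/-- The composite of the Frobenius `F : W_n(A) → W_n(A)` and `W_n(A) ⊆ W_n(Frac A)`. -/
def wittFrobenius : W p n A →+* W p n (FractionRing A) :=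
  wittMap p n ((algebraMap A (FractionRing A)).comp (frobenius A p))

/-- `F_* W_n(Frac A)`, as a `W_n(A)`-module. -/
abbrev FWFrac : Type _ := Along (wittFrobenius p n A) (W p n (FractionRing A))

variable {A}

/-- The `W_n(A)`-module `F_* W_n(A)(E)` of all `(a_0, …, a_{n-1}) ∈ W_n(Frac A)` with
`a_i ∈ A(p^i E)` for every `i`. For a normal noetherian domain `A` the displayed set is already
a submodule, so that taking the span adds nothing. -/
def FWTwist (E : QDivisor A) : Submodule (W p n A) (FWFrac p n A) :=
  Submodule.span (W p n A)
    {a | ∀ i : Fin n,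
      ((Along.of (wittFrobenius p n A)).symm a).coeff i ∈ sections ((p : ℚ) ^ (i : ℕ) • E)}

theorem one_mem_FWTwist {E : QDivisor A} (hE : 0 ≤ E) :
    Along.of (wittFrobenius p n A) (1 : W p n (FractionRing A)) ∈ FWTwist p n E := by
  apply Submodule.subset_span
  intro i
  have hc : ((Along.of (wittFrobenius p n A)).symm (Along.of (wittFrobenius p n A)
      (1 : W p n (FractionRing A)))).coeff i =
      (1 : WittVector p (FractionRing A)).coeff i := by
    rw [AddEquiv.symm_apply_apply, ← map_one (WittVector.truncate n), WittVector.coeff_truncate]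
  rw [hc]
  rcases Nat.eq_zero_or_pos (i : ℕ) with h0 | h0
  · right
    intro P
    rw [h0, WittVector.one_coeff_zero, ordFracAt_one]
    have hP := hE P
    simpa using hP
  · left
    exact WittVector.one_coeff_eq_of_pos p _ _ h0

/-- The map `F : W_n(A) → F_* W_n(A)(E)` for an effective divisor `E`; it is the composite of
`F : W_n(A) → F_* W_n(A)` and the inclusion. -/
def frobeniusTwist (E : QDivisor A) (hE : 0 ≤ E) : W p n A →ₗ[W p n A] FWTwist p n E where
  toFun w := ⟨Along.of (wittFrobenius p n A) (wittFrobenius p n A w), by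
    have h := (FWTwist p n E).smul_mem w (one_mem_FWTwist p n hE)
    rwa [Along.smul_of, smul_eq_mul, mul_one] at h⟩
  map_add' v w := by
    apply Subtype.ext
    change Along.of (wittFrobenius p n A) (wittFrobenius p n A (v + w)) =
      Along.of (wittFrobenius p n A) (wittFrobenius p n A v) +
        Along.of (wittFrobenius p n A) (wittFrobenius p n A w)
    rw [map_add, map_add]
  map_smul' v w := by
    apply Subtype.ext
    change Along.of (wittFrobenius p n A) (wittFrobenius p n A (v * w)) =
      v • Along.of (wittFrobenius p n A) (wittFrobenius p n A w)
    rw [Along.smul_of, map_mul, smul_eq_mul]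

variable [NeZero n]

/-- `Res : W_n(A) → A` as a map of `W_n(A)`-modules. -/
def resLinear (A : Type*) [CommRing A] : W p n A →ₗ[W p n A] Along (res p n A) A where
  toFun w := Along.of (res p n A) (res p n A w)
  map_add' v w := by rw [map_add, map_add]
  map_smul' v w := by
    rw [RingHom.id_apply, Along.smul_of, smul_eq_mul, smul_eq_mul, map_mul]

/-- The pushout `Q` of `F : W_n(A) → F_* W_n(A)(pD)` and `Res : W_n(A) → A`, in the category of
`W_n(A)`-modules. -/
abbrev Q (D : QDivisor A) (hD : 0 ≤ (p : ℚ) • D) : Type _ :=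
  (FWTwist p n ((p : ℚ) • D) × Along (res p n A) A) ⧸
    LinearMap.range ((frobeniusTwist p n ((p : ℚ) • D) hD).prod (-(resLinear p n A)))

/-- The structure map `A → Q` of the pushout. -/
def toQ (D : QDivisor A) (hD : 0 ≤ (p : ℚ) • D) : Along (res p n A) A →ₗ[W p n A] Q p n D hD :=
  (Submodule.mkQ _).comp (LinearMap.inr (W p n A) _ _)

/-- The pair `(A, D)` is `n`-quasi-`F`-split: evaluation at the image of `1 ∈ A` is a surjection
`Hom(Q, A) → A`. (The homomorphisms are those of `W_n(A)`-modules, `A` being a quotient of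
`W_n(A)`.) -/
def IsQuasiFSplit (D : QDivisor A) (hD : 0 ≤ (p : ℚ) • D) : Prop :=
  Function.Surjective fun ψ : Q p n D hD →ₗ[W p n A] Along (res p n A) A =>
    (Along.of (res p n A)).symm (ψ (toQ p n D hD (Along.of (res p n A) 1)))

end Pairs

/-! ### The non-splitting index -/

section Index

variable (p : ℕ) [Fact p.Prime] {A : Type*} [CommRing A]

/-- `D_n = (1 - 2 / p^n) div(f)`. -/
def nsDivisor (f : A) (n : ℕ) : QDivisor A := (1 - 2 / (p : ℚ) ^ n) • principalDivisor f

theorem nsDivisor_nonneg (f : A) (n : ℕ+) : 0 ≤ (p : ℚ) • nsDivisor p f n := by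
  have hp : (2 : ℚ) ≤ p := by exact_mod_cast (Fact.out : p.Prime).two_le
  have hpn : (2 : ℚ) ≤ (p : ℚ) ^ (n : ℕ) :=
    hp.trans (le_self_pow₀ (by linarith) n.ne_zero)
  have h1 : (0 : ℚ) ≤ 1 - 2 / (p : ℚ) ^ (n : ℕ) := by
    rw [sub_nonneg, div_le_one (by linarith)]
    exact hpn
  intro P
  have h2 : (0 : ℚ) ≤ (ordAt P f : ℚ) := by
    rw [ordAt]
    positivity
  change (0 : ℚ) ≤ (p : ℚ) * ((1 - 2 / (p : ℚ) ^ (n : ℕ)) * (ordAt P f : ℚ))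
  positivity

/-- The non-splitting index `ns(f)`: the infimum of all `n ≥ 1` such that `(A, D_n)` is not
`n`-quasi-`F`-split, and `∞` if there is none. -/
def nonSplittingIndex [CharP A p] (f : A) : ℕ∞ :=
  sInf {N : ℕ∞ | ∃ n : ℕ+, N = ((n : ℕ) : ℕ∞) ∧
    ¬ IsQuasiFSplit p (n : ℕ) (nsDivisor p f n) (nsDivisor_nonneg p f n)}

end Index

/-! ### The ideals `I^ns_n(f)` -/

section Fedder

variable {p : ℕ} [Fact p.Prime] {A : Type*} [CommRing A]

/-- The monomial `x_1^{e_1} ⋯ x_d^{e_d}` with exponents `0 ≤ e_i < p`. -/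
def pMonomial {d : ℕ} (x : Fin d → A) (e : Fin d → Fin p) : A := ∏ i, x i ^ (e i : ℕ)

variable (p) in
/-- `x_1, …, x_d` is a `p`-basis of `A`: the monomials `x^e` with `0 ≤ e_i < p` form a basis of
`F_* A` over `A`, that is, every `a ∈ A` is uniquely of the form `∑ c_e ^ p x^e`. -/
def IsPBasis {d : ℕ} (x : Fin d → A) : Prop :=
  ∀ a : A, ∃! c : (Fin d → Fin p) → A, a = ∑ e, c e ^ p * pMonomial x e

/-- The map `Δ`, defined by `[a] = ∑ [c_e ^ p x^e] + (0, Δ(a), …)` in the Witt vectors, where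
`a = ∑ c_e ^ p x^e` is the expansion of `a` in the `p`-basis. The value in `A` represents the
class `Δ(a) ∈ A / F(A)`. -/
def delta {d : ℕ} {x : Fin d → A} (hx : IsPBasis p x) (a : A) : A :=
  (WittVector.teichmuller p a -
    ∑ e, WittVector.teichmuller p ((hx a).choose e ^ p * pMonomial x e)).coeff 1

variable [CharP A p]

variable (p A) in
/-- `F_* A`, as an `A`-module. -/
abbrev FA : Type _ := Along (frobenius A p) A

/-- `u` generates `Hom_A(F_* A, A)` as a module over `F_* A`, the element `F_* b` acting on
homomorphisms by `φ ↦ φ(F_*(b · -))`. -/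
def IsGenerator (u : FA p A →ₗ[A] A) : Prop :=
  ∀ φ : FA p A →ₗ[A] A, ∃ b : A, ∀ a : A,
    φ (Along.of (frobenius A p) a) = u (Along.of (frobenius A p) (b * a))

/-- `F_* I ⊆ F_* A` for an ideal `I` of `A`. -/
def FIdeal (I : Ideal A) : Submodule A (FA p A) where
  carrier := {a | (Along.of (frobenius A p)).symm a ∈ I}
  add_mem' {a b} ha hb := by
    change (Along.of (frobenius A p)).symm (a + b) ∈ I
    rw [map_add]
    exact I.add_mem ha hb
  zero_mem' := I.zero_mem
  smul_mem' r a ha := I.mul_mem_left (frobenius A p r) ha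

/-- The homomorphism `θ_f(F_* a) = f^{p-2} u(F_*(Δ(f) a))` on `Ker(u)`. On `Ker(u)` it depends on
`Δ(f)` only modulo `F(A)`, because `u(F_*(b^p a)) = b u(F_* a)`. -/
def theta {d : ℕ} {x : Fin d → A} (hx : IsPBasis p x) (u : FA p A →ₗ[A] A) (f : A) :
    LinearMap.ker u →ₗ[A] A where
  toFun a := f ^ (p - 2) * u (Along.of (frobenius A p)
    (delta hx f * (Along.of (frobenius A p)).symm (a : FA p A)))
  map_add' a b := by
    rw [Submodule.coe_add, map_add, mul_add, map_add, map_add, mul_add]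
  map_smul' r a := by
    have h : Along.of (frobenius A p)
        (delta hx f * (Along.of (frobenius A p)).symm ((r • a : LinearMap.ker u) : FA p A)) =
        r • Along.of (frobenius A p)
          (delta hx f * (Along.of (frobenius A p)).symm (a : FA p A)) := by
      rw [Along.smul_of, smul_eq_mul]
      congr 1
      exact mul_left_comm (delta hx f) (frobenius A p r) _
    rw [h, map_smul, RingHom.id_apply, smul_eq_mul, smul_eq_mul, mul_left_comm]

/-- The ideals `I^ns_n(f)` for `n ≥ 1`: `I^ns_1(f) = f^{p-2} A` and
`I^ns_{n+1}(f) = θ_f(F_* I^ns_n(f) ∩ Ker(u)) + f^{p-1} A`. The value at `n = 0` is not used. -/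
def nsIdeal {d : ℕ} {x : Fin d → A} (hx : IsPBasis p x) (u : FA p A →ₗ[A] A) (f : A) :
    ℕ → Ideal A
  | 0 => ⊤
  | 1 => Ideal.span {f ^ (p - 2)}
  | n + 2 =>
    Submodule.map (theta hx u f)
      ((FIdeal (nsIdeal hx u f (n + 1))).comap (LinearMap.ker u).subtype) ⊔
      Ideal.span {f ^ (p - 1)}

variable (p) in
/-- The Frobenius power `I^[p]`, generated by the `p`-th powers of the elements of `I`. -/
def frobeniusPower (I : Ideal A) : Ideal A := I.map (frobenius A p)

end Fedder

end QuasiFSplit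

end

set_option linter.unusedSectionVars false

noncomputable section

namespace QuasiFSplit

open WittVector (teichmuller verschiebung)

/-! ### Identities for Witt vectors -/

section WittIdentities

variable {p : ℕ} [Fact p.Prime] {A : Type*} [CommRing A]

/-! A quasi-`F`-splitting at level `n = m + 1` is a `W_n(A)`-linear map from `F_* W_n(A)(pD_n)` to
`A` sending `1` to `1`. Multiplication by `[f ^ p]` clears the poles. If `A / f A` is reduced, it
turns the source into `F_* J_m`, where `J_m` is the ideal (`twistIdeal`) of vectors with `f ∣ w_i`
for `i < m` and `f ^ 2 ∣ w_m`. The question becomes whether some `ψ : F_* J_m → A` has `ψ([f ^ p]) =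
1`. Such a `ψ` itself forces `A / f A` to be reduced when `m ≥ 1`; for `m = 0` reducedness is not
needed (`isQuasiFSplit_iff_exists_isDual`).

The recursion comes from `J_{m+1} = [f] W(A) + V J_m`. Let `s` be the lift of `A` to `W(A)` given by
the `p`-basis; it is additive modulo `p`, and every `ψ` kills `p J_{m+1}`. By duality for `F_* A`,
`ψ` on `[f] s(a)` is `u(g a)` for some `g`, and on `V y` it is `u(χ(y))` with `χ` dual to `J_m`. The
pieces overlap in `[f] p W(A) = V([f ^ p] F W(A))`, so they glue precisely when `χ([f ^ p]) = 0`.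

Write `[f] = s(f) + V(δ)`, so that `δ_0` represents `Δ(f)`. Expanding `[f] ^ (p-1)` to first order
in `V(δ)` gives `ψ([f ^ p]) = u(h)` with `h = g f^(p-1) - f^(p-2) χ([f ^ p] δ)`
(`IsDual.apply_teichmuller_pow_mul`). Moreover `ψ([f ^ p] δ) ≡ u(Δ(f) h)` modulo `f`
(`IsDual.apply_teichmuller_pow_mul_wittDelta`), which rests on the shape of `δ` modulo `p`
(`exists_wittDelta_eq`). If `k` is the element attached to `χ`, then `u(k) = χ([f ^ p]) = 0` and `h
∈ -θ_f(k) + f^(p-1) A`. This is the recursion for the ideals.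

Hence `ψ` with value `1` exists if and only if `u` takes the value `1` on the ideal, which in a
local ring means that the ideal is not contained in `𝔪^[p]`. The translation from divisors to
divisibility needs `A` to be a normal domain: a regular local ring is a domain, and normality
follows from the `p`-basis. -/

theorem coeff_zero_add (v w : WittVector p A) :
    (v + w).coeff 0 = v.coeff 0 + w.coeff 0 :=
  map_add WittVector.constantCoeff v w

theorem coeff_zero_mul (v w : WittVector p A) :
    (v * w).coeff 0 = v.coeff 0 * w.coeff 0 :=
  map_mul WittVector.constantCoeff v w

theorem coeff_zero_pow (v : WittVector p A) (n : ℕ) : (v ^ n).coeff 0 = v.coeff 0 ^ n :=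
  map_pow WittVector.constantCoeff v n

theorem coeff_zero_one : (1 : WittVector p A).coeff 0 = 1 :=
  WittVector.one_coeff_zero p A

theorem coeff_zero_sum {ι : Type*} (s : Finset ι) (v : ι → WittVector p A) :
    (∑ i ∈ s, v i).coeff 0 = ∑ i ∈ s, (v i).coeff 0 :=
  map_sum WittVector.constantCoeff v s

theorem eq_verschiebung_shift {w : WittVector p A} (h : w.coeff 0 = 0) :
    w = verschiebung (w.shift 1) := by
  have := WittVector.eq_iterate_verschiebung (x := w) (n := 1) (by
    intro i hi
    obtain rfl : i = 0 := by omega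
    exact h)
  simpa using this

theorem eq_teichmuller_add_verschiebung (w : WittVector p A) :
    w = teichmuller p (w.coeff 0) + verschiebung (w.shift 1) := by
  ext i
  rw [WittVector.coeff_add_of_disjoint]
  · cases i with
    | zero => simp
    | succ i =>
      rw [WittVector.teichmuller_coeff_pos _ _ _ i.succ_pos,
        WittVector.verschiebung_coeff_succ, WittVector.shift_coeff, zero_add, add_comm 1]
  · intro i
    cases i with
    | zero => right; simp
    | succ i => left; exact WittVector.teichmuller_coeff_pos _ _ _ i.succ_pos

theorem teichmuller_add (a b : A) : ∃ w : WittVector p A,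
    teichmuller p a + teichmuller p b = teichmuller p (a + b) + verschiebung w := by
  have := eq_teichmuller_add_verschiebung (teichmuller p a + teichmuller p b)
  rw [coeff_zero_add, WittVector.teichmuller_coeff_zero, WittVector.teichmuller_coeff_zero] at this
  exact ⟨_, this⟩

theorem verschiebung_mul (v w : WittVector p A) :
    w * verschiebung v = verschiebung (WittVector.frobenius w * v) := by
  rw [mul_comm, ← WittVector.verschiebung_mul_frobenius, mul_comm]

theorem verschiebung_mul_verschiebung (v w : WittVector p A) :
    verschiebung v * verschiebung w = p * verschiebung (v * w) := by
  rw [verschiebung_mul, WittVector.frobenius_verschiebung, mul_right_comm, mul_comm,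
    ← nsmul_eq_mul, map_nsmul, nsmul_eq_mul]

theorem verschiebung_natCast_mul (n : ℕ) (w : WittVector p A) :
    verschiebung ((n : WittVector p A) * w) = n * verschiebung w := by
  rw [← nsmul_eq_mul, map_nsmul, nsmul_eq_mul]

theorem verschiebung_pow (w : WittVector p A) (k : ℕ) :
    verschiebung w ^ (k + 1) = (p : WittVector p A) ^ k * verschiebung (w ^ (k + 1)) := by
  induction k with
  | zero => simp
  | succ k ih =>
    rw [pow_succ, ih, mul_assoc, verschiebung_mul_verschiebung, ← pow_succ, ← mul_assoc, ← pow_succ]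

variable [CharP A p]

theorem frobenius_teichmuller (a : A) :
    WittVector.frobenius (teichmuller p a) = teichmuller p (a ^ p) := by
  rw [WittVector.frobenius_eq_map_frobenius, WittVector.map_teichmuller]
  rfl

theorem coeff_zero_frobenius (w : WittVector p A) :
    (WittVector.frobenius w).coeff 0 = w.coeff 0 ^ p :=
  WittVector.coeff_frobenius_charP _ _ _

theorem natCast_mul_eq_verschiebung (w : WittVector p A) :
    (p : WittVector p A) * w = verschiebung (WittVector.frobenius w) := by
  rw [WittVector.verschiebung_frobenius, mul_comm]

theorem coeff_zero_natCast_mul (w : WittVector p A) :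
    ((p : WittVector p A) * w).coeff 0 = 0 := by
  rw [natCast_mul_eq_verschiebung, WittVector.verschiebung_coeff_zero]

theorem frobenius_eq (w : WittVector p A) :
    WittVector.frobenius w = teichmuller p (w.coeff 0 ^ p) + p * w.shift 1 := by
  conv_lhs => rw [eq_teichmuller_add_verschiebung w]
  rw [map_add, frobenius_teichmuller, WittVector.frobenius_verschiebung, mul_comm]

/-- In `([w_0] + V z) ^ p` the mixed terms are divisible by `p`, and so is `V(z) ^ p = p ^ (p-1) V(z
^ p)`. What remains is `[w_0 ^ p]`, which is `F(w)` modulo `p` because `F V = p`. -/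
theorem exists_pow_eq_frobenius_add (w : WittVector p A) :
    ∃ z, w ^ p = WittVector.frobenius w + p * z := by
  have hp := (Fact.out : p.Prime)
  obtain ⟨r, hr⟩ := exists_add_pow_prime_eq hp (teichmuller p (w.coeff 0))
    (verschiebung (w.shift 1))
  rw [← eq_teichmuller_add_verschiebung] at hr
  obtain ⟨k, hk⟩ : ∃ k, p = k + 2 := ⟨p - 2, by have := hp.two_le; omega⟩
  have hV : verschiebung (w.shift 1) ^ p =
      (p : WittVector p A) * ((p : WittVector p A) ^ k * verschiebung (w.shift 1 ^ p)) := by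
    have := verschiebung_pow (w.shift 1) (k + 1)
    rw [show k + 1 + 1 = p by omega] at this
    rw [this, pow_succ]
    ring
  rw [hr, frobenius_eq, hV, ← map_pow]
  refine ⟨(p : WittVector p A) ^ k * verschiebung (w.shift 1 ^ p) +
    teichmuller p (w.coeff 0) * verschiebung (w.shift 1) * r - w.shift 1, ?_⟩
  ring

end WittIdentities

/-- Meant for `y = V(δ)`: then `y ^ 2 = p V(δ ^ 2)`, and the last term is divisible by `p ^ 2`. -/
theorem exists_add_pow_prime_eq_add_sq {R : Type*} [CommRing R] {p : ℕ} (hp : p.Prime) (x y : R) :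
    ∃ q, (x + y) ^ p = x ^ p + y ^ p + p * (x ^ (p - 1) * y) + p * (y ^ 2 * q) := by
  rw [add_pow_prime_eq' hp]
  have hmem : p - 1 ∈ Finset.Ioo 0 p := by
    have := hp.two_le
    simp only [Finset.mem_Ioo]; omega
  rw [← Finset.add_sum_erase _ _ hmem]
  have hdvd : y ^ 2 ∣ ∑ k ∈ (Finset.Ioo 0 p).erase (p - 1),
      x ^ k * y ^ (p - k) * ((p.choose k / p : ℕ) : R) := by
    refine Finset.dvd_sum fun k hk => ?_
    rw [Finset.mem_erase, Finset.mem_Ioo] at hk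
    exact ((pow_dvd_pow y (by omega)).mul_left _).mul_right _
  obtain ⟨q, hq⟩ := hdvd
  refine ⟨q, ?_⟩
  have h1 : p - (p - 1) = 1 := by have := hp.two_le; omega
  have h2 : p.choose (p - 1) / p = 1 := by
    rw [Nat.choose_symm_of_eq_add (show p = (p - 1) + 1 by have := hp.two_le; omega),
      Nat.choose_one_right, Nat.div_self hp.pos]
  rw [hq, h1, h2]
  push_cast
  ring

/-! ### Coordinates in a `p`-basis -/

section Coordinates

variable {p : ℕ} [Fact p.Prime] {A : Type*} [CommRing A] {d : ℕ} {x : Fin d → A}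

/-- The coefficient `c_e` in the expansion `a = ∑ c_e ^ p x^e`. -/
def coord (hx : IsPBasis p x) (a : A) (e : Fin d → Fin p) : A := (hx a).choose e

theorem sum_coord (hx : IsPBasis p x) (a : A) :
    ∑ e, coord hx a e ^ p * pMonomial x e = a :=
  (hx a).choose_spec.1.symm

theorem coord_unique (hx : IsPBasis p x) {a : A} {c : (Fin d → Fin p) → A}
    (h : a = ∑ e, c e ^ p * pMonomial x e) : coord hx a = c :=
  ((hx a).choose_spec.2 c h).symm

/-- The monomials `c ^ p x^e` form a multiplicative monoid. -/
def pMonomials (p : ℕ) [Fact p.Prime] (x : Fin d → A) : Submonoid A where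
  carrier := {m | ∃ (c : A) (e : Fin d → Fin p), m = c ^ p * pMonomial x e}
  one_mem' := by
    have hp := (Fact.out : p.Prime)
    exact ⟨1, fun _ => ⟨0, hp.pos⟩, by simp [pMonomial]⟩
  mul_mem' := by
    have hp := (Fact.out : p.Prime)
    rintro _ _ ⟨c, e, rfl⟩ ⟨c', e', rfl⟩
    -- Exponents are reduced modulo `p`, and the carries go into the `p`-th power.
    refine ⟨c * c' * ∏ i, x i ^ (((e i : ℕ) + e' i) / p),
      fun i => ⟨((e i : ℕ) + e' i) % p, Nat.mod_lt _ hp.pos⟩, ?_⟩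
    have h : pMonomial x e * pMonomial x e' = (∏ i, x i ^ (((e i : ℕ) + e' i) / p)) ^ p *
        pMonomial x fun i => (⟨((e i : ℕ) + e' i) % p, Nat.mod_lt _ hp.pos⟩ : Fin p) := by
      simp only [pMonomial, ← Finset.prod_mul_distrib, ← Finset.prod_pow]
      refine Finset.prod_congr rfl fun i _ => ?_
      rw [← pow_add, ← pow_mul, ← pow_add, mul_comm, Nat.div_add_mod]
    rw [mul_mul_mul_comm, h]
    ring

variable [CharP A p]

theorem coord_add (hx : IsPBasis p x) (a b : A) :
    coord hx (a + b) = coord hx a + coord hx b := by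
  refine coord_unique hx ?_
  conv_lhs => rw [← sum_coord hx a, ← sum_coord hx b]
  rw [← Finset.sum_add_distrib]
  refine Finset.sum_congr rfl fun e _ => ?_
  rw [Pi.add_apply, add_pow_char, add_mul]

theorem coord_pow_mul (hx : IsPBasis p x) (r a : A) :
    coord hx (r ^ p * a) = r • coord hx a := by
  refine coord_unique hx ?_
  conv_lhs => rw [← sum_coord hx a]
  rw [Finset.mul_sum]
  refine Finset.sum_congr rfl fun e _ => ?_
  rw [Pi.smul_apply, smul_eq_mul, mul_pow, mul_assoc]

theorem coord_monomial (hx : IsPBasis p x) (c : A) (e : Fin d → Fin p) :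
    coord hx (c ^ p * pMonomial x e) = Pi.single e c := by
  have hp := (Fact.out : p.Prime)
  refine coord_unique hx ?_
  rw [Finset.sum_eq_single e]
  · simp
  · intro e' _ he'
    rw [Pi.single_eq_of_ne he', zero_pow hp.ne_zero, zero_mul]
  · simp

/-! ### The multiplicative lift of a `p`-basis -/

/-- The lift `∑ [c_e ^ p x^e]` of `a = ∑ c_e ^ p x^e`. -/
def lift (hx : IsPBasis p x) (a : A) : WittVector p A :=
  ∑ e, teichmuller p (coord hx a e ^ p * pMonomial x e)

/-- The semiring of all sums of Teichmüller representatives of elements `c ^ p x^e`. -/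
def liftSemiring (p : ℕ) [Fact p.Prime] (x : Fin d → A) : Subsemiring (WittVector p A) :=
  ((pMonomials p x).map (teichmuller p)).subsemiringClosure

/-- The generators are closed under products, so sums of generators already form the semiring and no
multiplicative case is needed. -/
theorem liftSemiring_induction {P : WittVector p A → Prop}
    (hmon : ∀ (c : A) (e : Fin d → Fin p), P (teichmuller p (c ^ p * pMonomial x e))) (h0 : P 0)
    (hadd : ∀ s t, s ∈ liftSemiring p x → t ∈ liftSemiring p x → P s → P t → P (s + t))
    {s : WittVector p A} (hs : s ∈ liftSemiring p x) : P s := by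
  have hs' := Submonoid.subsemiringClosure_mem _ |>.1 hs
  induction hs' using AddSubmonoid.closure_induction with
  | mem s h =>
    obtain ⟨_, ⟨c, e, rfl⟩, rfl⟩ := h
    exact hmon c e
  | zero => exact h0
  | add s t h1 h2 ih1 ih2 =>
    have h1' := (Submonoid.subsemiringClosure_mem _).2 h1
    have h2' := (Submonoid.subsemiringClosure_mem _).2 h2
    exact hadd s t h1' h2' (ih1 h1') (ih2 h2')

theorem teichmuller_mem_liftSemiring (c : A) (e : Fin d → Fin p) :
    teichmuller p (c ^ p * pMonomial x e) ∈ liftSemiring p x :=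
  (Submonoid.subsemiringClosure_mem _).2 (AddSubmonoid.subset_closure ⟨_, ⟨c, e, rfl⟩, rfl⟩)

theorem teichmuller_pow_mem_liftSemiring (c : A) :
    teichmuller p (c ^ p) ∈ liftSemiring p x := by
  have hp := (Fact.out : p.Prime)
  have := teichmuller_mem_liftSemiring (x := x) c (fun _ => (⟨0, hp.pos⟩ : Fin p))
  simpa [pMonomial] using this

theorem lift_mem (hx : IsPBasis p x) (a : A) : lift hx a ∈ liftSemiring p x :=
  sum_mem fun e _ => teichmuller_mem_liftSemiring _ e

theorem coeff_zero_lift (hx : IsPBasis p x) (a : A) : (lift hx a).coeff 0 = a := by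
  rw [lift, coeff_zero_sum]
  simp only [WittVector.teichmuller_coeff_zero]
  exact sum_coord hx a

/-- In each coordinate `[a] + [b] - [a + b]` is some `V(w)`. The lift uses the Teichmüller
representatives of `p`-th powers, so `F` is applied to this identity and `F V = p` makes the error
divisible by `p`. -/
theorem lift_add (hx : IsPBasis p x) (a b : A) :
    ∃ r, lift hx a + lift hx b = lift hx (a + b) + p * r := by
  have h (e : Fin d → Fin p) : ∃ r : WittVector p A,
      teichmuller p (coord hx a e ^ p * pMonomial x e) +
      teichmuller p (coord hx b e ^ p * pMonomial x e) =
      teichmuller p (coord hx (a + b) e ^ p * pMonomial x e) + p * r := by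
    obtain ⟨w, hw⟩ := teichmuller_add (p := p) (coord hx a e) (coord hx b e)
    have hw' := congrArg WittVector.frobenius hw
    rw [map_add, map_add, frobenius_teichmuller, frobenius_teichmuller, frobenius_teichmuller,
      WittVector.frobenius_verschiebung] at hw'
    refine ⟨w * teichmuller p (pMonomial x e), ?_⟩
    rw [coord_add, Pi.add_apply, map_mul, map_mul, map_mul, ← add_mul, hw']
    ring
  choose r hr using h
  refine ⟨∑ e, r e, ?_⟩
  rw [lift, lift, lift, ← Finset.sum_add_distrib, Finset.mul_sum, ← Finset.sum_add_distrib]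
  exact Finset.sum_congr rfl fun e _ => hr e

theorem lift_monomial (hx : IsPBasis p x) (c : A) (e : Fin d → Fin p) :
    lift hx (c ^ p * pMonomial x e) = teichmuller p (c ^ p * pMonomial x e) := by
  have hp := (Fact.out : p.Prime)
  rw [lift, coord_monomial, Finset.sum_eq_single e]
  · simp
  · intro e' _ he'
    rw [Pi.single_eq_of_ne he', zero_pow hp.ne_zero, zero_mul, WittVector.teichmuller_zero]
  · simp

theorem lift_zero (hx : IsPBasis p x) : lift hx 0 = 0 := by
  have hp := (Fact.out : p.Prime)
  have := lift_monomial hx 0 (fun _ => (⟨0, hp.pos⟩ : Fin p))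
  rwa [zero_pow hp.ne_zero, zero_mul, WittVector.teichmuller_zero] at this

/-- An element of the lifted semiring is determined modulo `p` by its reduction. -/
theorem exists_eq_lift_add (hx : IsPBasis p x) {s : WittVector p A}
    (hs : s ∈ liftSemiring p x) : ∃ r, s = lift hx (s.coeff 0) + p * r := by
  refine liftSemiring_induction
    (P := fun s => ∃ r : WittVector p A, s = lift hx (s.coeff 0) + (p : WittVector p A) * r)
    ?_ ?_ ?_ hs
  · intro c e
    exact ⟨0, by rw [WittVector.teichmuller_coeff_zero, lift_monomial, mul_zero, add_zero]⟩
  · exact ⟨0, by rw [WittVector.zero_coeff, lift_zero, mul_zero, add_zero]⟩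
  · rintro s t - - ⟨r, hr⟩ ⟨r', hr'⟩
    obtain ⟨q, hq⟩ := lift_add hx (s.coeff 0) (t.coeff 0)
    refine ⟨r + r' + q, ?_⟩
    rw [coeff_zero_add, mul_add, mul_add, add_comm, add_comm (_ * r + _), ← add_assoc, ← hq]
    conv_lhs => rw [hr, hr']
    ring

/-- `s ^ p ≡ F(s)` modulo `p` times the lifted semiring. -/
theorem exists_pow_eq_of_mem_liftSemiring {s : WittVector p A} (hs : s ∈ liftSemiring p x) :
    ∃ t ∈ liftSemiring p x, s ^ p = WittVector.frobenius s + p * t := by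
  have hp := (Fact.out : p.Prime)
  refine liftSemiring_induction
    (P := fun s : WittVector p A => ∃ t ∈ liftSemiring p x, s ^ p = WittVector.frobenius s + p * t)
    ?_ ?_ ?_ hs
  · intro c e
    exact ⟨0, zero_mem _, by rw [frobenius_teichmuller, map_pow, mul_zero, add_zero]⟩
  · exact ⟨0, zero_mem _, by rw [map_zero, zero_pow hp.ne_zero, mul_zero, add_zero]⟩
  · rintro s t hs ht ⟨r, hr, hr'⟩ ⟨q, hq, hq'⟩
    -- The mixed binomial coefficients divided by `p` are natural numbers, so the correction stays
    -- in the semiring.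
    rw [add_pow_prime_eq' hp, hr', hq', map_add]
    refine ⟨r + q + ∑ k ∈ Finset.Ioo 0 p, s ^ k * t ^ (p - k) * ((p.choose k / p : ℕ) :
      WittVector p A), ?_, by ring⟩
    exact add_mem (add_mem hr hq) (sum_mem fun k _ => mul_mem (mul_mem (pow_mem hs _)
      (pow_mem ht _)) (natCast_mem _ _))

/-- The Witt vector `δ` with `[f] = ∑ [c_e ^ p x^e] + V(δ)`. -/
def wittDelta (hx : IsPBasis p x) (f : A) : WittVector p A :=
  (teichmuller p f - lift hx f).shift 1

theorem coeff_zero_wittDelta (hx : IsPBasis p x) (f : A) :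
    (wittDelta hx f).coeff 0 = delta hx f := rfl

theorem teichmuller_eq_lift_add (hx : IsPBasis p x) (f : A) :
    teichmuller p f = lift hx f + verschiebung (wittDelta hx f) := by
  have h : (teichmuller p f - lift hx f).coeff 0 = 0 := by
    have := map_sub WittVector.constantCoeff (teichmuller p f) (lift hx f)
    change (teichmuller p f - lift hx f).coeff 0 =
      (teichmuller p f).coeff 0 - (lift hx f).coeff 0 at this
    rw [this, WittVector.teichmuller_coeff_zero, coeff_zero_lift, sub_self]
  rw [wittDelta, ← eq_verschiebung_shift h]
  ring

theorem frobenius_lift (hx : IsPBasis p x) (f : A) :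
    WittVector.frobenius (lift hx f) = teichmuller p (f ^ p) - p * wittDelta hx f := by
  rw [← frobenius_teichmuller, teichmuller_eq_lift_add hx f, map_add,
    WittVector.frobenius_verschiebung]
  ring

/-- First-order expansion of `(s + V(δ)) ^ (p-1)`; the higher terms contain `V(δ) ^ 2 = p V(δ ^ 2)`.
-/
theorem exists_teichmuller_pow_pred (hx : IsPBasis p x) (f : A) :
    ∃ q, teichmuller p f ^ (p - 1) = lift hx f ^ (p - 1) +
      ((p - 1 : ℕ) : WittVector p A) * (lift hx f ^ (p - 2) * verschiebung (wittDelta hx f)) +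
      p * q := by
  obtain ⟨k, hk⟩ := Polynomial.powAddExpansion (lift hx f) (verschiebung (wittDelta hx f)) (p - 1)
  rw [teichmuller_eq_lift_add hx f, hk]
  refine ⟨k * verschiebung (wittDelta hx f * wittDelta hx f), ?_⟩
  rw [show p - 1 - 1 = p - 2 by omega, sq, verschiebung_mul_verschiebung]
  ring

/-- The structure of `δ` modulo `p`: up to an element of the lifted semiring it is of the form
`V([f ^ p] w + F(w'))`. -/
theorem exists_wittDelta_eq [IsDomain A] (hx : IsPBasis p x) (f : A) :
    ∃ t ∈ liftSemiring p x, ∃ w w' z : WittVector p A, wittDelta hx f =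
      t + verschiebung (teichmuller p (f ^ p) * w + WittVector.frobenius w') + p * z := by
  have hp := (Fact.out : p.Prime)
  obtain ⟨k, hk⟩ : ∃ k, p = k + 2 := ⟨p - 2, by have := hp.two_le; omega⟩
  -- With `s = lift hx f`, the element `[f ^ p]` is computed twice, as `F(s) + p δ` and as `(s +
  -- V(δ)) ^ p`. Comparing the two and dividing by `p` expresses `δ`.
  obtain ⟨t, ht, hst⟩ := exists_pow_eq_of_mem_liftSemiring (lift_mem hx f)
  obtain ⟨q, hq⟩ := exists_add_pow_prime_eq_add_sq hp (lift hx f) (verschiebung (wittDelta hx f))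
  obtain ⟨z, hz⟩ := exists_pow_eq_frobenius_add (wittDelta hx f)
  have hV : verschiebung (wittDelta hx f) ^ p = (p : WittVector p A) *
      ((p : WittVector p A) ^ k * verschiebung (wittDelta hx f ^ p)) := by
    have := verschiebung_pow (wittDelta hx f) (k + 1)
    rw [show k + 1 + 1 = p by omega] at this
    rw [this, pow_succ]
    ring
  rw [← teichmuller_eq_lift_add, ← map_pow, hst, hV, hz] at hq
  have hfl := frobenius_lift hx f
  -- `F(s) ≡ [f ^ p]` modulo `p`, and the exponent `p - 1` is positive.
  obtain ⟨w, v, hwv⟩ : ∃ w v : WittVector p A, WittVector.frobenius (lift hx f) ^ (p - 1) =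
      teichmuller p (f ^ p) * w + p * v := by
    refine ⟨WittVector.frobenius (lift hx f) ^ k,
      -(wittDelta hx f * WittVector.frobenius (lift hx f) ^ k), ?_⟩
    rw [show p - 1 = k + 1 by omega, pow_succ]
    nth_rewrite 2 [hfl]
    ring
  have hsD : lift hx f ^ (p - 1) * verschiebung (wittDelta hx f) =
      verschiebung (teichmuller p (f ^ p) * (w * wittDelta hx f)) +
        p * verschiebung (v * wittDelta hx f) := by
    have h : (teichmuller p (f ^ p) * w + p * v) * wittDelta hx f =
        teichmuller p (f ^ p) * (w * wittDelta hx f) + p * (v * wittDelta hx f) := by ring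
    rw [verschiebung_mul, map_pow, hwv, h, map_add, verschiebung_natCast_mul]
  rw [hsD, sq, verschiebung_mul_verschiebung] at hq
  have hp0 : (p : WittVector p A) ≠ 0 := WittVector.p_nonzero p A
  -- This is `V(δ) ^ p / p`. For `p = 2` the factor `p ^ k` is `1`, so the term survives modulo `p`;
  -- it is the source of `F(w')`.
  have hpk : (p : WittVector p A) ^ k * verschiebung (WittVector.frobenius (wittDelta hx f) +
        (p : WittVector p A) * z) =
        verschiebung (WittVector.frobenius ((p : WittVector p A) ^ k * wittDelta hx f)) +
        (p : WittVector p A) * ((p : WittVector p A) ^ k * verschiebung z) := by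
    rw [map_mul WittVector.frobenius, map_pow, map_natCast, map_add, verschiebung_natCast_mul,
      ← Nat.cast_pow, verschiebung_natCast_mul]
    ring
  rw [hpk] at hq
  refine ⟨t, ht, w * wittDelta hx f, (p : WittVector p A) ^ k * wittDelta hx f,
    verschiebung (v * wittDelta hx f) + verschiebung (wittDelta hx f * wittDelta hx f) * q +
      p ^ k * verschiebung z, mul_left_cancel₀ hp0 ?_⟩
  rw [map_add]
  rw [hfl] at hq
  linear_combination hq

end Coordinates

/-! ### Generators of `Hom(F_* A, A)` -/

/-- An additive map `v : A → A` is a trace generator if it is `p⁻¹`-linear, every `p⁻¹`-linear map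
is of the form `v(b · -)`, and the pairing `(b, a) ↦ v(b a)` is nondegenerate. -/
structure IsTraceGenerator (p : ℕ) {A : Type*} [CommRing A] (v : A →+ A) : Prop where
  pow_mul : ∀ r a, v (r ^ p * a) = r * v a
  exists_mul : ∀ φ : A →+ A, (∀ r a, φ (r ^ p * a) = r * φ a) → ∃ b, ∀ a, φ a = v (b * a)
  eq_zero : ∀ s, (∀ r, v (s * r) = 0) → s = 0

theorem IsTraceGenerator.mul_unique {p : ℕ} {A : Type*} [CommRing A] {v : A →+ A}
    (hv : IsTraceGenerator p v) {b c : A} (h : ∀ a, v (b * a) = v (c * a)) : b = c := by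
  refine sub_eq_zero.1 (hv.eq_zero _ fun r => ?_)
  rw [sub_mul, map_sub, h, sub_self]

section Dual

variable {p : ℕ} [Fact p.Prime] {A : Type*} [CommRing A]

/-! ### The ideals of twisted Witt vectors and their duals -/

/-- The ideal of all Witt vectors `w` with `w_i ∈ f A` for `i < n` and `w_n ∈ f^2 A`. -/
def twistIdeal (p : ℕ) [Fact p.Prime] (f : A) : ℕ → Ideal (WittVector p A)
  | 0 => (Ideal.span {f ^ 2}).comap WittVector.constantCoeff
  | n + 1 =>
    { carrier := {y | ∃ w, ∃ z ∈ twistIdeal p f n, y = teichmuller p f * w + verschiebung z}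
      zero_mem' := ⟨0, 0, zero_mem _, by simp⟩
      add_mem' := by
        rintro _ _ ⟨w, z, hz, rfl⟩ ⟨w', z', hz', rfl⟩
        refine ⟨w + w', z + z', add_mem hz hz', ?_⟩
        rw [map_add]
        ring
      smul_mem' := by
        rintro r _ ⟨w, z, hz, rfl⟩
        refine ⟨r * w, WittVector.frobenius r * z, Ideal.mul_mem_left _ _ hz, ?_⟩
        rw [smul_eq_mul, mul_add, verschiebung_mul]
        ring }

theorem mem_twistIdeal_zero {f : A} {y : WittVector p A} :
    y ∈ twistIdeal p f 0 ↔ f ^ 2 ∣ y.coeff 0 :=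
  Ideal.mem_span_singleton

theorem mem_twistIdeal_succ {f : A} {n : ℕ} {y : WittVector p A} :
    y ∈ twistIdeal p f (n + 1) ↔
      ∃ w, ∃ z ∈ twistIdeal p f n, y = teichmuller p f * w + verschiebung z :=
  Iff.rfl

theorem teichmuller_mul_mem {f : A} {n : ℕ} (w : WittVector p A) :
    teichmuller p f * w ∈ twistIdeal p f (n + 1) :=
  ⟨w, 0, zero_mem _, by simp⟩

theorem verschiebung_mem {f : A} {n : ℕ} {z : WittVector p A} (hz : z ∈ twistIdeal p f n) :
    verschiebung z ∈ twistIdeal p f (n + 1) :=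
  ⟨0, z, hz, by simp⟩

theorem teichmuller_pow_mul_mem {f : A} {n : ℕ} (w : WittVector p A) :
    teichmuller p (f ^ p) * w ∈ twistIdeal p f n := by
  have hp := (Fact.out : p.Prime).two_le
  cases n with
  | zero =>
    rw [mem_twistIdeal_zero, coeff_zero_mul, WittVector.teichmuller_coeff_zero]
    exact (pow_dvd_pow f hp).mul_right _
  | succ n =>
    rw [show f ^ p = f * f ^ (p - 1) by rw [← pow_succ']; congr 1; omega, map_mul, mul_assoc]
    exact teichmuller_mul_mem _

/-- A `W_{n+1}(A)`-linear map `F_* J → A`, where `J` is the `n`-th twisted ideal, given by its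
values on representatives in `W(A)`. -/
structure IsDual (f : A) (n : ℕ) (ψ : WittVector p A → A) : Prop where
  add : ∀ y ∈ twistIdeal p f n, ∀ z ∈ twistIdeal p f n, ψ (y + z) = ψ y + ψ z
  frobenius_mul : ∀ w, ∀ y ∈ twistIdeal p f n,
    ψ (WittVector.frobenius w * y) = w.coeff 0 * ψ y
  trunc : ∀ y ∈ RingHom.ker (WittVector.truncate (p := p) (R := A) (n + 1)), ψ y = 0

theorem verschiebung_mem_ker_truncate {n : ℕ} {y : WittVector p A}
    (hy : y ∈ RingHom.ker (WittVector.truncate (p := p) (R := A) n)) :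
    verschiebung y ∈ RingHom.ker (WittVector.truncate (p := p) (R := A) (n + 1)) := by
  rw [WittVector.mem_ker_truncate] at hy ⊢
  intro i hi
  cases i with
  | zero => exact WittVector.verschiebung_coeff_zero _
  | succ i =>
    rw [WittVector.verschiebung_coeff_succ]
    exact hy i (by omega)

theorem mem_ker_truncate_of_verschiebung {n : ℕ} {y : WittVector p A}
    (hy : verschiebung y ∈ RingHom.ker (WittVector.truncate (p := p) (R := A) (n + 1))) :
    y ∈ RingHom.ker (WittVector.truncate (p := p) (R := A) n) := by
  rw [WittVector.mem_ker_truncate] at hy ⊢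
  intro i hi
  have := hy (i + 1) (by omega)
  rwa [WittVector.verschiebung_coeff_add_one] at this

theorem mem_twistIdeal_of_mem_ker_truncate {f : A} {n : ℕ} {y : WittVector p A}
    (hy : y ∈ RingHom.ker (WittVector.truncate (p := p) (R := A) (n + 1))) :
    y ∈ twistIdeal p f n := by
  induction n generalizing y with
  | zero =>
    rw [mem_twistIdeal_zero, (WittVector.mem_ker_truncate _ _).1 hy 0 (by omega)]
    exact dvd_zero _
  | succ n ih =>
    have h0 := (WittVector.mem_ker_truncate _ _).1 hy 0 (by omega)
    rw [eq_verschiebung_shift h0] at hy ⊢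
    exact verschiebung_mem (ih (mem_ker_truncate_of_verschiebung hy))

namespace IsDual

variable {f : A} {n : ℕ} {ψ : WittVector p A → A}

theorem zero (h : IsDual f n ψ) : ψ 0 = 0 := h.trunc 0 (zero_mem _)

theorem nsmul (h : IsDual f n ψ) (k : ℕ) {y : WittVector p A} (hy : y ∈ twistIdeal p f n) :
    ψ (k * y) = k * ψ y := by
  induction k with
  | zero => simp [h.zero]
  | succ k ih =>
    push_cast
    rw [add_mul, one_mul, h.add _ (Ideal.mul_mem_left _ _ hy) _ hy, ih]
    ring

variable [CharP A p]

theorem natCast_mul (h : IsDual f n ψ) {y : WittVector p A} (hy : y ∈ twistIdeal p f n) :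
    ψ (p * y) = 0 := by
  rw [h.nsmul p hy, CharP.cast_eq_zero, zero_mul]

end IsDual

variable [CharP A p] {f : A} {n : ℕ} {d : ℕ} {x : Fin d → A} {v : A →+ A}

/-- The restriction of a dual element to `[f]` times the lifted semiring. -/
theorem IsDual.exists_eq_on_lift (hx : IsPBasis p x) (hv : IsTraceGenerator p v)
    {ψ : WittVector p A → A} (h : IsDual f (n + 1) ψ) :
    ∃ g, ∀ t ∈ liftSemiring p x, ψ (teichmuller p f * t) = v (g * t.coeff 0) := by
  have hmon (c : A) (e : Fin d → Fin p) :
      ψ (teichmuller p f * teichmuller p (c ^ p * pMonomial x e)) =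
        c * ψ (teichmuller p f * teichmuller p (pMonomial x e)) := by
    have := h.frobenius_mul (teichmuller p c) _
      (teichmuller_mul_mem (teichmuller p (pMonomial x e)))
    rw [WittVector.teichmuller_coeff_zero, frobenius_teichmuller] at this
    rw [← this, map_mul]
    congr 1
    ring
  -- Defined coordinatewise, `φ` is visibly `p⁻¹`-linear. It agrees with `ψ([f] t)` because both are
  -- additive in `t` and agree on monomials.
  let φ : A →+ A :=
    { toFun := fun a => ∑ e, coord hx a e * ψ (teichmuller p f * teichmuller p (pMonomial x e))
      map_zero' := by
        refine Finset.sum_eq_zero fun e _ => ?_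
        have : coord hx 0 = 0 := by simpa using coord_add hx 0 0
        rw [this, Pi.zero_apply, zero_mul]
      map_add' := fun a b => by
        simp only [coord_add, Pi.add_apply, add_mul, Finset.sum_add_distrib] }
  have hφ (a : A) : φ a = ∑ e, coord hx a e *
    ψ (teichmuller p f * teichmuller p (pMonomial x e)) := rfl
  obtain ⟨g, hg⟩ := hv.exists_mul φ (by
    intro r a
    rw [hφ, hφ, coord_pow_mul, Finset.mul_sum]
    exact Finset.sum_congr rfl fun e _ => by rw [Pi.smul_apply, smul_eq_mul, mul_assoc])
  refine ⟨g, fun t ht => ?_⟩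
  rw [← hg]
  refine liftSemiring_induction (P := fun t => ψ (teichmuller p f * t) = φ (t.coeff 0))
    ?_ ?_ ?_ ht
  · intro c e
    rw [hmon, hφ, WittVector.teichmuller_coeff_zero, coord_monomial, Finset.sum_eq_single e]
    · rw [Pi.single_eq_same]
    · intro e' _ he'
      rw [Pi.single_eq_of_ne he', zero_mul]
    · simp
  · rw [mul_zero, h.zero, WittVector.zero_coeff, map_zero]
  · intro s t _ _ hs ht
    rw [mul_add, h.add _ (teichmuller_mul_mem s) _ (teichmuller_mul_mem t), hs, ht,
      coeff_zero_add, map_add]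

/-- The restriction of a dual element to the image of `V`. -/
theorem IsDual.exists_eq_on_verschiebung (hv : IsTraceGenerator p v)
    {ψ : WittVector p A → A} (h : IsDual f (n + 1) ψ) :
    ∃ χ : WittVector p A → A, IsDual f n χ ∧ χ (teichmuller p (f ^ p)) = 0 ∧
      ∀ y ∈ twistIdeal p f n, ψ (verschiebung y) = v (χ y) := by
  have hker (r : WittVector p A) {y : WittVector p A} (hy : y ∈ twistIdeal p f n) :
      ψ (verschiebung (p * (r * y))) = 0 := by
    rw [verschiebung_natCast_mul]
    exact h.natCast_mul (verschiebung_mem (Ideal.mul_mem_left _ _ hy))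
  -- `F(r)` is `[r_0 ^ p]` plus a multiple of `p`, and `ψ ∘ V` kills multiples of `p`. So only `r_0`
  -- matters, which makes the map below additive in `a`.
  have hcongr (a : A) (r : WittVector p A) {y : WittVector p A} (hy : y ∈ twistIdeal p f n)
      (hr : r.coeff 0 = a) : ψ (verschiebung (WittVector.frobenius r * y)) =
        ψ (verschiebung (WittVector.frobenius (teichmuller p a) * y)) := by
    rw [frobenius_eq, hr, frobenius_teichmuller, add_mul, mul_assoc, map_add,
      h.add _ (verschiebung_mem (Ideal.mul_mem_left _ _ hy)) _
        (verschiebung_mem (Ideal.mul_mem_left _ _ (Ideal.mul_mem_left _ _ hy))), hker _ hy,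
      add_zero]
  have hex (y : WittVector p A) (hy : y ∈ twistIdeal p f n) : ∃ b, ∀ a,
      ψ (verschiebung (WittVector.frobenius (teichmuller p a) * y)) = v (b * a) := by
    let φ : A →+ A := AddMonoidHom.mk'
      (fun a => ψ (verschiebung (WittVector.frobenius (teichmuller p a) * y))) (by
        intro a b
        rw [← hcongr (a + b) (teichmuller p a + teichmuller p b) hy (by simp [coeff_zero_add]),
          map_add, add_mul, map_add]
        exact h.add _ (verschiebung_mem (Ideal.mul_mem_left _ _ hy)) _
          (verschiebung_mem (Ideal.mul_mem_left _ _ hy)))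
    refine hv.exists_mul φ fun r a => ?_
    change ψ (verschiebung _) = r * ψ (verschiebung _)
    have := h.frobenius_mul (teichmuller p r) _ (verschiebung_mem
      (Ideal.mul_mem_left _ (WittVector.frobenius (teichmuller p a)) hy))
    rw [WittVector.teichmuller_coeff_zero] at this
    rw [← this, verschiebung_mul, map_mul (teichmuller p), map_mul WittVector.frobenius,
      ← frobenius_teichmuller, mul_assoc]
  classical
  choose! χ hχ using hex
  have hf : teichmuller p (f ^ p) ∈ twistIdeal p f n := by
    simpa using teichmuller_pow_mul_mem (f := f) (n := n) (1 : WittVector p A)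
  refine ⟨χ, ⟨?_, ?_, ?_⟩, ?_, ?_⟩
  · intro y hy z hz
    refine hv.mul_unique fun a => ?_
    rw [add_mul, map_add, ← hχ y hy, ← hχ z hz, ← hχ _ (add_mem hy hz), mul_add, map_add]
    exact h.add _ (verschiebung_mem (Ideal.mul_mem_left _ _ hy)) _
      (verschiebung_mem (Ideal.mul_mem_left _ _ hz))
  · intro w y hy
    refine hv.mul_unique fun a => ?_
    rw [← hχ _ (Ideal.mul_mem_left _ _ hy), mul_comm (w.coeff 0), mul_assoc, ← hχ y hy,
      ← mul_assoc, ← map_mul]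
    refine hcongr _ _ hy ?_
    rw [coeff_zero_mul, WittVector.teichmuller_coeff_zero, mul_comm]
  · intro y hy
    refine hv.mul_unique fun a => ?_
    rw [← hχ _ (mem_twistIdeal_of_mem_ker_truncate hy), zero_mul, map_zero]
    exact h.trunc _ (verschiebung_mem_ker_truncate (Ideal.mul_mem_left _ _ hy))
  -- `V([f ^ p] F[a]) = V F([a] [f]) = p [a] [f]`, and `ψ` kills it.
  · refine hv.mul_unique fun a => ?_
    rw [← hχ _ hf, zero_mul, map_zero, ← frobenius_teichmuller, ← map_mul,
      ← natCast_mul_eq_verschiebung]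
    exact h.natCast_mul (Ideal.mul_mem_left _ _
      (by simpa using teichmuller_mul_mem (f := f) (n := n) (1 : WittVector p A)))
  · intro y hy
    have := hχ y hy 1
    rwa [map_one, map_one, one_mul, mul_one] at this

/-- Dual elements can be glued from their restrictions to `[f]` times the lifted semiring and to
the image of `V`. -/
theorem IsDual.exists_of_restrictions [IsDomain A] (hf : f ≠ 0) (hx : IsPBasis p x)
    (hv : IsTraceGenerator p v) (g : A) {χ : WittVector p A → A} (hχ : IsDual f n χ)
    (hχf : χ (teichmuller p (f ^ p)) = 0) :
    ∃ ψ : WittVector p A → A, IsDual f (n + 1) ψ ∧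
      (∀ t ∈ liftSemiring p x, ψ (teichmuller p f * t) = v (g * t.coeff 0)) ∧
      ∀ y ∈ twistIdeal p f n, ψ (verschiebung y) = v (χ y) := by
  have hfmem : teichmuller p (f ^ p) ∈ twistIdeal p f n := by
    simpa using teichmuller_pow_mul_mem (f := f) (n := n) (1 : WittVector p A)
  have hkill (r : WittVector p A) :
      χ (WittVector.frobenius r * teichmuller p (f ^ p)) = 0 := by
    rw [hχ.frobenius_mul _ _ hfmem, hχf, mul_zero]
  -- The overlap of the two pieces. By `hkill`, `χ` vanishes on it, so the glued map is well
  -- defined.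
  have hpf (r : WittVector p A) : teichmuller p f * (p * r) =
      verschiebung (WittVector.frobenius r * teichmuller p (f ^ p)) := by
    rw [natCast_mul_eq_verschiebung, verschiebung_mul, frobenius_teichmuller, mul_comm]
  have hex : ∀ y ∈ twistIdeal p f (n + 1), ∃ c, ∃ s ∈ liftSemiring p x,
      ∃ z ∈ twistIdeal p f n, y = teichmuller p f * s + verschiebung z ∧
        c = v (g * s.coeff 0) + v (χ z) := by
    rintro _ ⟨w, z, hz, rfl⟩
    obtain ⟨r, hr⟩ : ∃ r, w = lift hx (w.coeff 0) + verschiebung r := by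
      refine ⟨(w - lift hx (w.coeff 0)).shift 1, ?_⟩
      rw [← eq_verschiebung_shift]
      · ring
      · have := map_sub WittVector.constantCoeff w (lift hx (w.coeff 0))
        change (w - lift hx (w.coeff 0)).coeff 0 =
          w.coeff 0 - (lift hx (w.coeff 0)).coeff 0 at this
        rw [this, coeff_zero_lift, sub_self]
    refine ⟨_, _, lift_mem hx (w.coeff 0), teichmuller p (f ^ p) * r + z,
      add_mem (teichmuller_pow_mul_mem _) hz, ?_, rfl⟩
    conv_lhs => rw [hr]
    rw [mul_add, verschiebung_mul, frobenius_teichmuller, map_add, add_assoc]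
  -- A decomposition is chosen for each element of the ideal; the values elsewhere are irrelevant.
  choose! ψ hψ using hex
  have huniq {s : WittVector p A} (hs : s ∈ liftSemiring p x) {z : WittVector p A}
      (hz : z ∈ twistIdeal p f n) :
      ψ (teichmuller p f * s + verschiebung z) = v (g * s.coeff 0) + v (χ z) := by
    obtain ⟨t, ht, y, hy, heq, hval⟩ := hψ (teichmuller p f * s + verschiebung z)
      (mem_twistIdeal_succ.2 ⟨s, z, hz, rfl⟩)
    rw [hval]
    -- Equal reductions make `s - t` a multiple of `p`; after multiplication by `[f]` this
    -- difference moves into the `V`-part, where `χ` does not see it.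
    have h0 : s.coeff 0 = t.coeff 0 := by
      have := congrArg (fun w : WittVector p A => w.coeff 0) heq
      simp only [coeff_zero_add, coeff_zero_mul, WittVector.teichmuller_coeff_zero,
        WittVector.verschiebung_coeff_zero, add_zero] at this
      exact mul_left_cancel₀ hf this
    obtain ⟨r, hr⟩ := exists_eq_lift_add hx hs
    obtain ⟨q, hq⟩ := exists_eq_lift_add hx ht
    have hst : s = t + p * (r - q) := by
      rw [hr, hq, h0]
      ring
    have hyz : y = z + WittVector.frobenius (r - q) * teichmuller p (f ^ p) := by
      apply WittVector.verschiebung_injective p A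
      rw [map_add, ← hpf]
      rw [hst] at heq
      linear_combination -heq
    rw [h0, hyz, hχ.add _ hz _ (Ideal.mul_mem_left _ _ hfmem), hkill, add_zero]
  refine ⟨ψ, ⟨?_, ?_, ?_⟩, ?_, ?_⟩
  · intro y hy y' hy'
    obtain ⟨s, hs, z, hz, rfl, hval⟩ := hψ y hy
    obtain ⟨s', hs', z', hz', rfl, hval'⟩ := hψ y' hy'
    rw [hval, hval', show teichmuller p f * s + verschiebung z +
      (teichmuller p f * s' + verschiebung z') = teichmuller p f * (s + s') +
      verschiebung (z + z') by rw [map_add]; ring, huniq (add_mem hs hs') (add_mem hz hz'),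
      coeff_zero_add, hχ.add _ hz _ hz', mul_add, map_add, map_add]
    ring
  · intro w y hy
    obtain ⟨s, hs, z, hz, rfl, hval⟩ := hψ y hy
    have h1 : WittVector.frobenius w * (teichmuller p f * s + verschiebung z) =
        teichmuller p f * (teichmuller p (w.coeff 0 ^ p) * s) +
        verschiebung (WittVector.frobenius (w.shift 1 * s) * teichmuller p (f ^ p) +
          WittVector.frobenius (WittVector.frobenius w) * z) := by
      rw [map_add, ← hpf, mul_add, verschiebung_mul]
      nth_rewrite 1 [frobenius_eq w]
      ring
    rw [hval, h1, huniq (mul_mem (teichmuller_pow_mem_liftSemiring _) hs)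
      (add_mem (Ideal.mul_mem_left _ _ hfmem) (Ideal.mul_mem_left _ _ hz)),
      hχ.add _ (Ideal.mul_mem_left _ _ hfmem) _ (Ideal.mul_mem_left _ _ hz), hkill, zero_add,
      hχ.frobenius_mul _ _ hz, coeff_zero_mul, WittVector.teichmuller_coeff_zero,
      coeff_zero_frobenius, hv.pow_mul, mul_left_comm, hv.pow_mul, mul_add]
  · intro y hy
    have h0 := (WittVector.mem_ker_truncate _ _).1 hy 0 (by omega)
    rw [eq_verschiebung_shift h0] at hy ⊢
    have hy' := mem_ker_truncate_of_verschiebung hy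
    have := huniq (zero_mem _) (mem_twistIdeal_of_mem_ker_truncate hy')
    rw [hχ.trunc _ hy'] at this
    simpa using this
  · intro t ht
    simpa [hχ.zero] using huniq ht (zero_mem _)
  · intro y hy
    simpa using huniq (zero_mem _) hy

end Dual

/-! ### Values of dual elements and the ideals `I^ns_n(f)` -/

section Values

variable {p : ℕ} [Fact p.Prime] {A : Type*} [CommRing A] [CharP A p]
  {d : ℕ} {x : Fin d → A} {f : A} {n : ℕ} {v : A →+ A}

/-- The value of a dual element at `[f ^ p] t`, for `t` in the lifted semiring. -/
theorem IsDual.apply_teichmuller_pow_mul (hx : IsPBasis p x) {ψ χ : WittVector p A → A}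
    (hψ : IsDual f (n + 1) ψ) (hχ : IsDual f n χ) {g : A}
    (hg : ∀ t ∈ liftSemiring p x, ψ (teichmuller p f * t) = v (g * t.coeff 0))
    (hψχ : ∀ y ∈ twistIdeal p f n, ψ (verschiebung y) = v (χ y))
    {t : WittVector p A} (ht : t ∈ liftSemiring p x) :
    ψ (teichmuller p (f ^ p) * t) = v (t.coeff 0 *
      (g * f ^ (p - 1) - f ^ (p - 2) * χ (teichmuller p (f ^ p) * wittDelta hx f))) := by
  have hp := (Fact.out : p.Prime).two_le
  obtain ⟨q, hq⟩ := exists_teichmuller_pow_pred hx f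
  have hs := lift_mem hx f
  have hmem := teichmuller_pow_mul_mem (p := p) (f := f) (n := n) (wittDelta hx f)
  have hsplit : teichmuller p (f ^ p) * t = teichmuller p f * (lift hx f ^ (p - 1) * t) +
      (((p - 1 : ℕ) : WittVector p A) * verschiebung
        (WittVector.frobenius (lift hx f ^ (p - 2) * t) *
          (teichmuller p (f ^ p) * wittDelta hx f)) + p * (teichmuller p f * (q * t))) := by
    have h1 : teichmuller p (f ^ p) = teichmuller p f * teichmuller p f ^ (p - 1) := by
      rw [← pow_succ', map_pow, show p - 1 + 1 = p by omega]
    have h2 : verschiebung (WittVector.frobenius (lift hx f ^ (p - 2) * t) *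
        (teichmuller p (f ^ p) * wittDelta hx f)) =
        lift hx f ^ (p - 2) * t * (teichmuller p f * verschiebung (wittDelta hx f)) := by
      rw [verschiebung_mul, verschiebung_mul, frobenius_teichmuller]
    rw [h2, h1, hq]
    ring
  have hV := verschiebung_mem (Ideal.mul_mem_left (twistIdeal p f n)
    (WittVector.frobenius (lift hx f ^ (p - 2) * t)) hmem)
  have hpm := teichmuller_mul_mem (p := p) (f := f) (n := n) (q * t)
  -- Source of the minus sign in the formula.
  have hcast : ((p - 1 : ℕ) : A) = -1 := by
    rw [Nat.cast_sub (by omega), CharP.cast_eq_zero, Nat.cast_one, zero_sub]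
  rw [hsplit, hψ.add _ (teichmuller_mul_mem _) _ (add_mem (Ideal.mul_mem_left _ _ hV)
    (Ideal.mul_mem_left _ _ hpm)), hψ.add _ (Ideal.mul_mem_left _ _ hV) _
    (Ideal.mul_mem_left _ _ hpm), hψ.natCast_mul hpm, hψ.nsmul _ hV,
    hψχ _ (Ideal.mul_mem_left _ _ hmem), hχ.frobenius_mul _ _ hmem,
    hg _ (mul_mem (pow_mem hs _) ht), hcast, coeff_zero_mul, coeff_zero_mul, coeff_zero_pow,
    coeff_zero_pow, coeff_zero_lift, add_zero, neg_one_mul, ← map_neg, ← map_add]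
  congr 1
  ring

/-- The value of a dual element at `[f ^ p] δ`, modulo `f`. -/
theorem IsDual.apply_teichmuller_pow_mul_wittDelta [IsDomain A] (hx : IsPBasis p x)
    (hv : IsTraceGenerator p v) {ψ χ : WittVector p A → A}
    (hψ : IsDual f (n + 1) ψ) (hχ : IsDual f n χ) (hχf : χ (teichmuller p (f ^ p)) = 0) {g : A}
    (hg : ∀ t ∈ liftSemiring p x, ψ (teichmuller p f * t) = v (g * t.coeff 0))
    (hψχ : ∀ y ∈ twistIdeal p f n, ψ (verschiebung y) = v (χ y)) :
    f ∣ ψ (teichmuller p (f ^ p) * wittDelta hx f) - v (delta hx f *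
      (g * f ^ (p - 1) - f ^ (p - 2) * χ (teichmuller p (f ^ p) * wittDelta hx f))) := by
  have hp := (Fact.out : p.Prime).two_le
  obtain ⟨t, ht, w, w', z, h⟩ := exists_wittDelta_eq hx f
  have h0 : delta hx f = t.coeff 0 := by
    rw [← coeff_zero_wittDelta, h, coeff_zero_add, coeff_zero_add,
      WittVector.verschiebung_coeff_zero, coeff_zero_natCast_mul, add_zero, add_zero]
  have hfmem : teichmuller p (f ^ p) ∈ twistIdeal p f n := by
    simpa using teichmuller_pow_mul_mem (f := f) (n := n) (1 : WittVector p A)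
  have hfw := teichmuller_pow_mul_mem (p := p) (f := f) (n := n) w
  -- `[f ^ p]` enters the `V`-part of `δ` as `F[f ^ p]`. On the term with `w` this yields `v(f ^ p
  -- ⋯) = f v(⋯)`; the term with `w'` becomes an `F`-multiple of `[f ^ p]`, which `χ` kills.
  have hsplit : teichmuller p (f ^ p) * wittDelta hx f = teichmuller p (f ^ p) * t +
      (verschiebung (WittVector.frobenius (teichmuller p (f ^ p)) * (teichmuller p (f ^ p) * w) +
        WittVector.frobenius (teichmuller p (f ^ (p - 1)) * w') * teichmuller p (f ^ p)) +
        p * (teichmuller p (f ^ p) * z)) := by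
    have h1 : WittVector.frobenius (teichmuller p (f ^ (p - 1)) * w') * teichmuller p (f ^ p) =
        WittVector.frobenius (teichmuller p (f ^ p)) * WittVector.frobenius w' := by
      rw [map_mul, mul_right_comm, frobenius_teichmuller, ← map_mul, ← mul_pow, ← pow_succ,
        show p - 1 + 1 = p by omega, ← frobenius_teichmuller]
    have h2 (a b : WittVector p A) :
        verschiebung (WittVector.frobenius (teichmuller p (f ^ p)) * a +
          WittVector.frobenius (teichmuller p (f ^ p)) * b) =
        teichmuller p (f ^ p) * verschiebung (a + b) := by
      rw [verschiebung_mul, mul_add]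
    rw [h1, h2]
    conv_lhs => rw [h]
    ring
  have hA := Ideal.mul_mem_left (twistIdeal p f n)
    (WittVector.frobenius (teichmuller p (f ^ p))) hfw
  have hB := Ideal.mul_mem_left (twistIdeal p f n)
    (WittVector.frobenius (teichmuller p (f ^ (p - 1)) * w')) hfmem
  have hV := verschiebung_mem (add_mem hA hB)
  have hpz := teichmuller_pow_mul_mem (p := p) (f := f) (n := n + 1) z
  have key : ψ (teichmuller p (f ^ p) * wittDelta hx f) = v (delta hx f *
      (g * f ^ (p - 1) - f ^ (p - 2) * χ (teichmuller p (f ^ p) * wittDelta hx f))) +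
      f * v (χ (teichmuller p (f ^ p) * w)) := by
    rw [h0, ← hψ.apply_teichmuller_pow_mul hx hχ hg hψχ ht]
    conv_lhs => rw [hsplit]
    rw [hψ.add _ (teichmuller_pow_mul_mem _) _ (add_mem hV (Ideal.mul_mem_left _ _ hpz)),
      hψ.add _ hV _ (Ideal.mul_mem_left _ _ hpz), hψ.natCast_mul hpz, hψχ _ (add_mem hA hB),
      hχ.add _ hA _ hB, hχ.frobenius_mul _ _ hfw, hχ.frobenius_mul _ _ hfmem, hχf, mul_zero,
      add_zero, add_zero, WittVector.teichmuller_coeff_zero, hv.pow_mul]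
  rw [key, add_sub_cancel_left]
  exact dvd_mul_right _ _

/-- Dual elements of the first twisted ideal are given by elements of `A`. -/
theorem IsDual.exists_eq_of_zero (hv : IsTraceGenerator p v) {ψ : WittVector p A → A}
    (h : IsDual f 0 ψ) : ∃ b, ∀ w : WittVector p A,
      ψ (teichmuller p (f ^ 2) * w) = v (b * w.coeff 0) := by
  have hmem (w : WittVector p A) : teichmuller p (f ^ 2) * w ∈ twistIdeal p f 0 := by
    rw [mem_twistIdeal_zero, coeff_zero_mul, WittVector.teichmuller_coeff_zero]
    exact dvd_mul_right _ _
  have hcongr (w : WittVector p A) : ψ (teichmuller p (f ^ 2) * w) =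
      ψ (teichmuller p (f ^ 2) * teichmuller p (w.coeff 0)) := by
    conv_lhs => rw [eq_teichmuller_add_verschiebung w]
    rw [mul_add, h.add _ (hmem _) _ (hmem _), h.trunc (_ * verschiebung _), add_zero]
    rw [WittVector.mem_ker_truncate]
    intro i hi
    obtain rfl : i = 0 := by omega
    rw [coeff_zero_mul, WittVector.verschiebung_coeff_zero, mul_zero]
  let φ : A →+ A := AddMonoidHom.mk' (fun a => ψ (teichmuller p (f ^ 2) * teichmuller p a)) (by
    intro a b
    rw [← h.add _ (hmem _) _ (hmem _), ← mul_add, hcongr (_ + _), coeff_zero_add,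
      WittVector.teichmuller_coeff_zero, WittVector.teichmuller_coeff_zero])
  obtain ⟨b, hb⟩ := hv.exists_mul φ (by
    intro r a
    change ψ _ = r * ψ _
    have := h.frobenius_mul (teichmuller p r) _ (hmem (teichmuller p a))
    rw [WittVector.teichmuller_coeff_zero, frobenius_teichmuller] at this
    rw [← this, map_mul]
    congr 1
    ring)
  refine ⟨b, fun w => ?_⟩
  rw [hcongr, ← hb]
  rfl

theorem IsDual.exists_of_zero [IsDomain A] (hf : f ≠ 0) (hv : IsTraceGenerator p v) (b : A) :
    ∃ ψ : WittVector p A → A, IsDual f 0 ψ ∧ ∀ w : WittVector p A,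
      ψ (teichmuller p (f ^ 2) * w) = v (b * w.coeff 0) := by
  have hex : ∀ y ∈ twistIdeal p f 0, ∃ a, y.coeff 0 = f ^ 2 * a := fun y hy =>
    mem_twistIdeal_zero.1 hy
  -- On the ideal, `c y` is the quotient `y_0 / f ^ 2`.
  choose! c hc using hex
  have hf2 : f ^ 2 ≠ 0 := pow_ne_zero 2 hf
  have huniq {y : WittVector p A} {a : A} (h : y.coeff 0 = f ^ 2 * a) : c y = a := by
    have := hc y (mem_twistIdeal_zero.2 ⟨a, h⟩)
    rw [h] at this
    exact (mul_left_cancel₀ hf2 this).symm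
  refine ⟨fun y => v (b * c y), ⟨?_, ?_, ?_⟩, ?_⟩
  · intro y hy z hz
    rw [huniq (y := y + z) (a := c y + c z) (by rw [coeff_zero_add, hc y hy, hc z hz, mul_add]),
      mul_add, map_add]
  · intro w y hy
    rw [huniq (y := WittVector.frobenius w * y) (a := w.coeff 0 ^ p * c y)
      (by rw [coeff_zero_mul, coeff_zero_frobenius, hc y hy]; ring), mul_left_comm, hv.pow_mul]
  · intro y hy
    have := (WittVector.mem_ker_truncate _ _).1 hy 0 (by omega)
    rw [huniq (y := y) (a := 0) (by rw [this, mul_zero]), mul_zero, map_zero]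
  · intro w
    beta_reduce
    rw [huniq (y := teichmuller p (f ^ 2) * w) (a := w.coeff 0)
      (by rw [coeff_zero_mul, WittVector.teichmuller_coeff_zero])]

theorem mem_nsIdeal_succ_succ (hx : IsPBasis p x) (u : FA p A →ₗ[A] A) (f h : A) (n : ℕ) :
    h ∈ nsIdeal hx u f (n + 2) ↔ ∃ k ∈ nsIdeal hx u f (n + 1),
      u (Along.of (frobenius A p) k) = 0 ∧ ∃ g, h = f ^ (p - 2) *
        u (Along.of (frobenius A p) (delta hx f * k)) + g * f ^ (p - 1) := by
  rw [nsIdeal, Submodule.mem_sup]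
  constructor
  · rintro ⟨_, ⟨⟨k, hk0⟩, hk, rfl⟩, _, hg, rfl⟩
    obtain ⟨g, rfl⟩ := Ideal.mem_span_singleton'.1 hg
    exact ⟨(Along.of (frobenius A p)).symm k, hk, hk0, g, rfl⟩
  · rintro ⟨k, hk, hk0, g, rfl⟩
    exact ⟨_, ⟨⟨Along.of (frobenius A p) k, hk0⟩, hk, rfl⟩, _,
      Ideal.mem_span_singleton'.2 ⟨g, rfl⟩, rfl⟩

/-- The additive map underlying a homomorphism `F_* A → A`. -/
def toAddHom (u : FA p A →ₗ[A] A) : A →+ A :=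
  u.toAddMonoidHom.comp (Along.of (frobenius A p)).toAddMonoidHom

/-- The relation between dual elements and elements of `I^ns_n(f)` used in the comparison. -/
def Matches (hx : IsPBasis p x) (v : A →+ A) (f : A) (ψ : WittVector p A → A) (h : A) : Prop :=
  ψ (teichmuller p (f ^ p)) = v h ∧
    f ∣ ψ (teichmuller p (f ^ p) * wittDelta hx f) - v (delta hx f * h)

/-- The exponent `p - 2` of the first ideal comes from `[f ^ p] = [f ^ 2] [f ^ (p-2)]`. -/
theorem matches_zero (hx : IsPBasis p x) {ψ : WittVector p A → A} {b : A}
    (hb : ∀ w : WittVector p A, ψ (teichmuller p (f ^ 2) * w) = v (b * w.coeff 0)) :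
    Matches hx v f ψ (b * f ^ (p - 2)) := by
  have hp := (Fact.out : p.Prime).two_le
  have h1 : teichmuller p (f ^ p) = teichmuller p (f ^ 2) * teichmuller p (f ^ (p - 2)) := by
    rw [← map_mul, ← pow_add, show 2 + (p - 2) = p by omega]
  constructor
  · rw [h1, hb, WittVector.teichmuller_coeff_zero]
  · rw [h1, mul_assoc, hb, coeff_zero_mul, WittVector.teichmuller_coeff_zero, coeff_zero_wittDelta,
      show b * (f ^ (p - 2) * delta hx f) = delta hx f * (b * f ^ (p - 2)) by ring, sub_self]
    exact dvd_zero _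

/-- The value at `[f ^ p] δ` is needed only modulo `f`: the next level multiplies it by `f ^ (p-2)`,
and the error falls into `f ^ (p-1) A`. -/
theorem matches_succ [IsDomain A] (hx : IsPBasis p x)
    (hv : IsTraceGenerator p v) {ψ χ : WittVector p A → A}
    (hψ : IsDual f (n + 1) ψ) (hχ : IsDual f n χ) (hχf : χ (teichmuller p (f ^ p)) = 0) {g : A}
    (hg : ∀ t ∈ liftSemiring p x, ψ (teichmuller p f * t) = v (g * t.coeff 0))
    (hψχ : ∀ y ∈ twistIdeal p f n, ψ (verschiebung y) = v (χ y)) :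
    Matches hx v f ψ
      (g * f ^ (p - 1) - f ^ (p - 2) * χ (teichmuller p (f ^ p) * wittDelta hx f)) := by
  refine ⟨?_, hψ.apply_teichmuller_pow_mul_wittDelta hx hv hχ hχf hg hψχ⟩
  have := hψ.apply_teichmuller_pow_mul hx hχ hg hψχ (one_mem _)
  rwa [mul_one, coeff_zero_one, one_mul] at this

variable [IsDomain A] {u : FA p A →ₗ[A] A}

theorem IsDual.exists_matches (hx : IsPBasis p x) (hu : IsTraceGenerator p (toAddHom u))
    {ψ : WittVector p A → A} (hψ : IsDual f n ψ) :
    ∃ h ∈ nsIdeal hx u f (n + 1), Matches hx (toAddHom u) f ψ h := by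
  have hp := (Fact.out : p.Prime).two_le
  induction n generalizing ψ with
  | zero =>
    obtain ⟨b, hb⟩ := hψ.exists_eq_of_zero hu
    exact ⟨_, Ideal.mem_span_singleton'.2 ⟨b, rfl⟩, matches_zero hx hb⟩
  | succ n ih =>
    obtain ⟨g, hg⟩ := hψ.exists_eq_on_lift hx hu
    obtain ⟨χ, hχ, hχf, hψχ⟩ := hψ.exists_eq_on_verschiebung hu
    obtain ⟨k, hk, hk1, r, hr⟩ := ih hχ
    refine ⟨_, ?_, matches_succ hx hu hψ hχ hχf hg hψχ⟩
    rw [mem_nsIdeal_succ_succ]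
    have hk0 : toAddHom u k = 0 := hk1.symm.trans hχf
    -- `-k` compensates for the sign `p - 1 = -1`, and `g - r` absorbs the error modulo `f`.
    refine ⟨-k, neg_mem hk, ?_, g - r, ?_⟩
    · change toAddHom u (-k) = 0
      rw [map_neg, hk0, neg_zero]
    · change _ = f ^ (p - 2) * toAddHom u (delta hx f * -k) + _
      rw [mul_neg, map_neg]
      have h1 : f ^ (p - 1) = f ^ (p - 2) * f := by
        rw [← pow_succ, show p - 2 + 1 = p - 1 by omega]
      rw [h1]
      linear_combination (-f ^ (p - 2)) * hr

theorem exists_isDual_matches (hf : f ≠ 0) (hx : IsPBasis p x)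
    (hu : IsTraceGenerator p (toAddHom u)) {h : A} (hh : h ∈ nsIdeal hx u f (n + 1)) :
    ∃ ψ : WittVector p A → A, IsDual f n ψ ∧ Matches hx (toAddHom u) f ψ h := by
  have hp := (Fact.out : p.Prime).two_le
  induction n generalizing h with
  | zero =>
    obtain ⟨b, rfl⟩ := Ideal.mem_span_singleton'.1 hh
    obtain ⟨ψ, hψ, hb⟩ := IsDual.exists_of_zero hf hu b
    exact ⟨ψ, hψ, matches_zero hx hb⟩
  | succ n ih =>
    obtain ⟨k, hk, hk0, g, rfl⟩ := (mem_nsIdeal_succ_succ hx u f h n).1 hh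
    obtain ⟨χ, hχ, hχk, r, hr⟩ := ih (neg_mem hk)
    have hχf : χ (teichmuller p (f ^ p)) = 0 := by
      rw [hχk, map_neg, neg_eq_zero]
      exact hk0
    -- The shift by `r` cancels the error `f r` in the value of `χ` at `[f ^ p] δ`, so `h` is hit
    -- exactly.
    obtain ⟨ψ, hψ, hg, hψχ⟩ := IsDual.exists_of_restrictions hf hx hu (g + r) hχ hχf
    refine ⟨ψ, hψ, ?_⟩
    have := matches_succ hx hu hψ hχ hχf hg hψχ
    convert this using 1
    change f ^ (p - 2) * toAddHom u (delta hx f * k) + _ = _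
    rw [mul_neg, map_neg] at hr
    have h1 : f ^ (p - 1) = f ^ (p - 2) * f := by
      rw [← pow_succ, show p - 2 + 1 = p - 1 by omega]
    rw [h1]
    linear_combination f ^ (p - 2) * hr

/-- Dual elements with value `1` at `[f ^ p]` correspond to elements of `I^ns_{n+1}(f)` on which
the generator takes the value `1`. -/
theorem exists_isDual_apply_eq_one_iff (hf : f ≠ 0) (hx : IsPBasis p x)
    (hu : IsTraceGenerator p (toAddHom u)) :
    (∃ ψ : WittVector p A → A, IsDual f n ψ ∧ ψ (teichmuller p (f ^ p)) = 1) ↔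
      ∃ h ∈ nsIdeal hx u f (n + 1), toAddHom u h = 1 := by
  constructor
  · rintro ⟨ψ, hψ, h1⟩
    obtain ⟨h, hh, hm, -⟩ := hψ.exists_matches hx hu
    exact ⟨h, hh, hm.symm.trans h1⟩
  · rintro ⟨h, hh, h1⟩
    obtain ⟨ψ, hψ, hm, -⟩ := exists_isDual_matches hf hx hu hh
    exact ⟨ψ, hψ, hm.trans h1⟩

/-! ### The criterion in terms of `𝔪^[p]` -/

/-- Nondegeneracy holds because the coordinate functionals of the `p`-basis are among the maps `u(b
· -)`. -/
theorem isTraceGenerator_of_isGenerator (hx : IsPBasis p x) (hu : IsGenerator u) :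
    IsTraceGenerator p (toAddHom u) where
  pow_mul r a := u.map_smul r (Along.of (frobenius A p) a)
  exists_mul φ hφ := by
    let φ' : FA p A →ₗ[A] A :=
      { toFun := fun a => φ ((Along.of (frobenius A p)).symm a)
        map_add' := fun a b => by rw [map_add, map_add]
        map_smul' := fun r a => hφ r _ }
    exact hu φ'
  eq_zero s hs := by
    have hcoord (e : Fin d → Fin p) : coord hx s e = 0 := by
      let φ : FA p A →ₗ[A] A :=
        { toFun := fun a => coord hx ((Along.of (frobenius A p)).symm a) e
          map_add' := fun a b => by rw [map_add, coord_add, Pi.add_apply]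
          map_smul' := fun r a => congrFun (coord_pow_mul hx r _) e }
      obtain ⟨b, hb⟩ := hu φ
      have := hb s
      rw [mul_comm] at this
      exact this.trans (hs b)
    have hp := (Fact.out : p.Prime)
    rw [← sum_coord hx s]
    exact Finset.sum_eq_zero fun e _ => by rw [hcoord, zero_pow hp.ne_zero, zero_mul]

/-- The coordinates of `h` have the form `u(b h)`; if they lie in `I`, the expansion `∑ c_e ^ p x^e`
puts `h` in `I^[p]`. -/
theorem mem_frobeniusPower_iff (hx : IsPBasis p x) (hu : IsGenerator u) (I : Ideal A) (h : A) :
    h ∈ frobeniusPower p I ↔ ∀ r, toAddHom u (r * h) ∈ I := by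
  constructor
  · intro hh
    refine Submodule.span_induction (p := fun h _ => ∀ r, toAddHom u (r * h) ∈ I)
      ?_ ?_ ?_ ?_ hh
    · rintro _ ⟨a, ha, rfl⟩ r
      rw [mul_comm]
      have : toAddHom u (a ^ p * r) = a * toAddHom u r :=
        (isTraceGenerator_of_isGenerator hx hu).pow_mul a r
      change toAddHom u (a ^ p * r) ∈ I
      rw [this]
      exact I.mul_mem_right _ ha
    · intro r
      rw [mul_zero, map_zero]
      exact I.zero_mem
    · intro a b _ _ ha hb r
      rw [mul_add, map_add]
      exact I.add_mem (ha r) (hb r)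
    · intro c a _ ha r
      rw [smul_eq_mul, ← mul_assoc]
      exact ha _
  · intro hh
    rw [← sum_coord hx h]
    refine Ideal.sum_mem _ fun e _ => Ideal.mul_mem_right _ _ ?_
    refine Ideal.mem_map_of_mem (frobenius A p) ?_
    let φ : FA p A →ₗ[A] A :=
      { toFun := fun a => coord hx ((Along.of (frobenius A p)).symm a) e
        map_add' := fun a b => by rw [map_add, coord_add, Pi.add_apply]
        map_smul' := fun r a => congrFun (coord_pow_mul hx r _) e }
    obtain ⟨b, hb⟩ := hu φ
    have h1 : coord hx h e = toAddHom u (b * h) := hb h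
    exact h1 ▸ hh b

/-- If `u(r h)` is outside `𝔪` it is a unit, and multiplying `r h` by the `p`-th power of its
inverse gives the value `1`. -/
theorem exists_apply_eq_one_iff [IsLocalRing A] (hx : IsPBasis p x) (hu : IsGenerator u)
    (I : Ideal A) :
    (∃ h ∈ I, toAddHom u h = 1) ↔ ¬ I ≤ frobeniusPower p (IsLocalRing.maximalIdeal A) := by
  have hv := isTraceGenerator_of_isGenerator hx hu
  constructor
  · rintro ⟨h, hh, h1⟩ hle
    have := (mem_frobeniusPower_iff hx hu _ h).1 (hle hh) 1
    rw [one_mul, h1, IsLocalRing.mem_maximalIdeal] at this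
    exact this isUnit_one
  · intro hle
    obtain ⟨h, hh, hnot⟩ := SetLike.not_le_iff_exists.1 hle
    rw [mem_frobeniusPower_iff hx hu] at hnot
    push Not at hnot
    obtain ⟨r, hr⟩ := hnot
    rw [IsLocalRing.mem_maximalIdeal, mem_nonunits_iff, not_not] at hr
    obtain ⟨c, hc⟩ := hr.exists_left_inv
    exact ⟨c ^ p * (r * h), I.mul_mem_left _ (I.mul_mem_left _ hh), by rw [hv.pow_mul, hc]⟩

theorem exists_isDual_iff [IsLocalRing A] (hf : f ≠ 0) (hx : IsPBasis p x) (hu : IsGenerator u) :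
    (∃ ψ : WittVector p A → A, IsDual f n ψ ∧ ψ (teichmuller p (f ^ p)) = 1) ↔
      ¬ nsIdeal hx u f (n + 1) ≤ frobeniusPower p (IsLocalRing.maximalIdeal A) := by
  rw [exists_isDual_apply_eq_one_iff hf hx (isTraceGenerator_of_isGenerator hx hu),
    exists_apply_eq_one_iff hx hu]

end Values

/-! ### Regular local rings are domains -/

section Regular

open IsLocalRing

/-- Dividing a local ring by an element of `𝔪 ∖ 𝔪^2` lowers the embedding dimension. -/
theorem spanFinrank_maximalIdeal_quotient_lt {R : Type*} [CommRing R] [IsLocalRing R]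
    [IsNoetherianRing R] {x : R} (hx : x ∈ maximalIdeal R) (hx2 : x ∉ maximalIdeal R ^ 2)
    [IsLocalRing (R ⧸ Ideal.span {x})] :
    (maximalIdeal (R ⧸ Ideal.span {x})).spanFinrank < (maximalIdeal R).spanFinrank := by
  let k := ResidueField R
  let c : CotangentSpace R := (maximalIdeal R).toCotangent ⟨x, hx⟩
  have hc : c ≠ 0 := fun h => hx2 (((maximalIdeal R).toCotangent_eq_zero _).1 h)
  let L : Submodule k (CotangentSpace R) := Submodule.span k {c}
  have hL : Module.finrank k (CotangentSpace R ⧸ L) + 1 = (maximalIdeal R).spanFinrank := by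
    rw [spanFinrank_maximalIdeal_eq_finrank_cotangentSpace, ← L.finrank_quotient_add_finrank]
    congr 1
    exact (finrank_span_singleton hc).symm
  let b := Module.finBasis k (CotangentSpace R ⧸ L)
  have hlift (i : Fin (Module.finrank k (CotangentSpace R ⧸ L))) : ∃ y : maximalIdeal R,
      L.mkQ ((maximalIdeal R).toCotangent y) = b i := by
    obtain ⟨z, hz⟩ := L.mkQ_surjective (b i)
    obtain ⟨y, rfl⟩ := (maximalIdeal R).toCotangent_surjective z
    exact ⟨y, hz⟩
  choose y hy using hlift
  have hspan : Submodule.span k (Set.image (maximalIdeal R).toCotangent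
      (insert ⟨x, hx⟩ (Set.range y))) = ⊤ := by
    have hle : L ≤ Submodule.span k (Set.image (maximalIdeal R).toCotangent
        (insert ⟨x, hx⟩ (Set.range y))) :=
      Submodule.span_mono (Set.singleton_subset_iff.2 ⟨_, Set.mem_insert _ _, rfl⟩)
    have hmap : Submodule.map L.mkQ (Submodule.span k (Set.image (maximalIdeal R).toCotangent
        (insert ⟨x, hx⟩ (Set.range y)))) = ⊤ := by
      rw [eq_top_iff, ← b.span_eq, Submodule.span_le]
      rintro _ ⟨i, rfl⟩
      exact ⟨_, Submodule.subset_span ⟨y i, Set.mem_insert_of_mem _ ⟨i, rfl⟩, rfl⟩, hy i⟩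
    have := Submodule.comap_map_mkQ L (Submodule.span k (Set.image (maximalIdeal R).toCotangent
        (insert ⟨x, hx⟩ (Set.range y))))
    rw [hmap, Submodule.comap_top, sup_eq_right.2 hle] at this
    exact this.symm
  -- Nakayama: `x` and the lifts `y i` generate `𝔪`, so the `y i` alone generate it modulo `x`.
  rw [CotangentSpace.span_image_eq_top_iff] at hspan
  let π := Ideal.Quotient.mk (Ideal.span {x})
  have hgen : maximalIdeal (R ⧸ Ideal.span {x}) =
      Ideal.span (Set.range fun i => π (y i)) := by
    apply le_antisymm
    · intro z hz
      obtain ⟨r, rfl⟩ := Ideal.Quotient.mk_surjective z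
      have hr : r ∈ maximalIdeal R := by
        rw [mem_maximalIdeal, mem_nonunits_iff] at hz ⊢
        exact fun h => hz (h.map _)
      have hmem : (⟨r, hr⟩ : maximalIdeal R) ∈
          Submodule.span R (insert ⟨x, hx⟩ (Set.range y)) := hspan ▸ Submodule.mem_top
      refine Submodule.span_induction
        (p := fun (r : maximalIdeal R) _ => π r ∈ Ideal.span (Set.range fun i => π (y i)))
        ?_ ?_ ?_ ?_ hmem
      · rintro _ (rfl | ⟨i, rfl⟩)
        · rw [show π x = 0 from Ideal.Quotient.eq_zero_iff_mem.2 (Ideal.mem_span_singleton_self x)]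
          exact zero_mem _
        · exact Ideal.subset_span ⟨i, rfl⟩
      · rw [Submodule.coe_zero, map_zero]; exact zero_mem _
      · intro a b _ _ ha hb
        rw [Submodule.coe_add, map_add]; exact add_mem ha hb
      · intro r a _ ha
        rw [Submodule.coe_smul, smul_eq_mul, map_mul]
        exact Ideal.mul_mem_left _ _ ha
    · rw [Ideal.span_le]
      rintro _ ⟨i, rfl⟩
      rw [SetLike.mem_coe, mem_maximalIdeal, mem_nonunits_iff]
      intro hunit
      obtain ⟨z, hz⟩ := hunit.exists_left_inv
      obtain ⟨r, rfl⟩ := Ideal.Quotient.mk_surjective z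
      have h1 : r * y i - 1 ∈ Ideal.span {x} := by
        rw [← Ideal.Quotient.eq_zero_iff_mem, map_sub, map_mul, map_one, sub_eq_zero]
        exact hz
      have h2 : r * y i - 1 ∈ maximalIdeal R :=
        ((Ideal.span_singleton_le_iff_mem _).2 hx) h1
      have h3 := sub_mem (Ideal.mul_mem_left (maximalIdeal R) r (y i).2) h2
      simp at h3
  rw [hgen]
  have hfin : (Set.range fun i => π (y i)).Finite := Set.finite_range _
  refine lt_of_le_of_lt (Submodule.spanFinrank_span_le_ncard_of_finite hfin) ?_
  rw [← hL, Nat.lt_succ_iff]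
  have := Set.ncard_image_le (f := fun i => π (y i)) (Set.finite_univ)
  rw [Set.image_univ, Set.ncard_univ, Nat.card_eq_fintype_card, Fintype.card_fin] at this
  exact this

/-- Induction on the embedding dimension. Unless `𝔪 = 0`, prime avoidance gives `x ∈ 𝔪` outside
`𝔪^2` and all minimal primes. Then `R / x` is regular of smaller embedding dimension, so `(x)` is
prime. A minimal prime `P ⊆ (x)` satisfies `P = x P` since `x ∉ P`, hence `P = 0` by Nakayama. -/
theorem isDomain_of_isRegularLocalRing (R : Type*) [CommRing R] [hR : IsRegularLocalRing R] :
    IsDomain R := by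
  induction hd : (maximalIdeal R).spanFinrank using Nat.strong_induction_on generalizing R with
  | _ d ih =>
  have hdim : ((maximalIdeal R).spanFinrank : WithBot ℕ∞) = ringKrullDim R :=
    hR.spanFinrank_maximalIdeal
  by_cases hm : maximalIdeal R = ⊥
  · have := isField_iff_maximalIdeal_eq.2 hm
    exact this.isDomain
  have hfin : (insert (maximalIdeal R ^ 2) (minimalPrimes R)).Finite :=
    (minimalPrimes.finite_of_isNoetherianRing R).insert _
  have hav : ¬ ((maximalIdeal R : Set R) ⊆
      ⋃ I ∈ insert (maximalIdeal R ^ 2) (minimalPrimes R), ((id I : Ideal R) : Set R)) := by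
    -- Prime avoidance allows two ideals that need not be prime; `𝔪^2` fills both places.
    rw [Ideal.subset_union_prime_finite hfin (f := id) (maximalIdeal R ^ 2) (maximalIdeal R ^ 2)]
    · rintro ⟨I, rfl | hI, hle⟩
      · refine hm (Submodule.eq_bot_of_le_smul_of_le_jacobson_bot (maximalIdeal R) _
          (IsNoetherian.noetherian _) ?_ (IsLocalRing.maximalIdeal_le_jacobson _))
        rw [smul_eq_mul, ← sq]
        exact hle
      · have hIp : I.IsPrime := hI.1.1
        have hIm : maximalIdeal R = I := le_antisymm hle (le_maximalIdeal hIp.ne_top)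
        have h0 : (maximalIdeal R).height = 0 := Ideal.height_eq_zero_iff.2 (hIm ▸ hI)
        have h1 : ringKrullDim R = 0 := by
          rw [← maximalIdeal_height_eq_ringKrullDim, h0]
          rfl
        rw [h1] at hdim
        have h2 : (maximalIdeal R).spanFinrank = 0 := by exact_mod_cast hdim
        exact hm ((Submodule.spanFinrank_eq_zero_iff_eq_bot (IsNoetherian.noetherian _)).1 h2)
    · rintro I (rfl | hI) h _
      · exact absurd rfl h
      · exact hI.1.1
  obtain ⟨x, hx, hxn⟩ := Set.not_subset.1 hav
  simp only [Set.mem_iUnion, not_exists] at hxn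
  have hx2 : x ∉ maximalIdeal R ^ 2 := hxn _ (Set.mem_insert _ _)
  have hxP : ∀ P ∈ minimalPrimes R, x ∉ P := fun P hP => hxn P (Set.mem_insert_of_mem _ hP)
  have hne : Ideal.span {x} ≠ ⊤ := by
    rw [Ne, Ideal.span_singleton_eq_top]
    exact (mem_maximalIdeal x).1 hx
  have : Nontrivial (R ⧸ Ideal.span {x}) := Ideal.Quotient.nontrivial_iff.2 hne
  have : IsLocalRing (R ⧸ Ideal.span {x}) :=
    IsLocalRing.of_surjective' (Ideal.Quotient.mk _) Ideal.Quotient.mk_surjective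
  have hlt := spanFinrank_maximalIdeal_quotient_lt hx hx2
  have hreg : IsRegularLocalRing (R ⧸ Ideal.span {x}) := by
    apply IsRegularLocalRing.of_spanFinrank_maximalIdeal_le
    have h1 := ringKrullDim_le_ringKrullDim_quotient_add_card ({x} : Finset R) (by
      rw [Finset.coe_singleton, Set.singleton_subset_iff]
      rw [← IsLocalRing.ringJacobson_eq_maximalIdeal] at hx
      exact hx)
    rw [Finset.card_singleton, Finset.coe_singleton, ← hdim] at h1
    have h2 : ((maximalIdeal (R ⧸ Ideal.span {x})).spanFinrank : WithBot ℕ∞) + (1 : ℕ) ≤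
        ((maximalIdeal R).spanFinrank : WithBot ℕ∞) := by
      exact_mod_cast hlt
    exact ENat.WithBot.add_le_add_natCast_right_iff.1 (h2.trans h1)
  have hdom : IsDomain (R ⧸ Ideal.span {x}) := ih _ (hd ▸ hlt) _ rfl
  have hprime : (Ideal.span {x}).IsPrime := (Ideal.Quotient.isDomain_iff_prime _).1 hdom
  obtain ⟨P, hP, hPle⟩ := Ideal.exists_minimalPrimes_le (bot_le : ⊥ ≤ Ideal.span {x})
  have hPp : P.IsPrime := hP.1.1
  have hPbot : P = ⊥ := by
    refine Submodule.eq_bot_of_le_smul_of_le_jacobson_bot (Ideal.span {x}) P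
      (IsNoetherian.noetherian _) ?_ ?_
    · intro y hy
      obtain ⟨z, rfl⟩ := Ideal.mem_span_singleton'.1 (hPle hy)
      have hz : z ∈ P := (hPp.mem_or_mem hy).resolve_right (hxP P hP)
      rw [mul_comm]
      exact Submodule.smul_mem_smul (Ideal.mem_span_singleton_self x) hz
    · exact ((Ideal.span_singleton_le_iff_mem _).2 hx).trans
        (IsLocalRing.maximalIdeal_le_jacobson _)
  rw [hPbot] at hPp
  exact IsDomain.of_bot_isPrime R

end Regular

/-! ### Normality -/

section Normal

variable {p : ℕ} [Fact p.Prime] {A : Type*} [CommRing A] [CharP A p]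
  {d : ℕ} {x : Fin d → A}

/-- Taking `p`-basis coordinates lowers `k` by one: the coordinates of `c` satisfy the same
divisibility one level down. Their `p`-th powers gain enough in the `𝔪`-adic order, since `p (k + 1)
≥ k + 2`. -/
theorem mem_maximalIdeal_pow_of_mul_pow_dvd [IsLocalRing A] [IsDomain A] (hx : IsPBasis p x)
    {a b : A} (hab : ¬ b ∣ a) (k : ℕ) {c : A} (h : b ^ p ^ k ∣ c * a ^ p ^ k) :
    c ∈ IsLocalRing.maximalIdeal A ^ (k + 1) := by
  have hp := (Fact.out : p.Prime).two_le
  induction k generalizing c with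
  | zero =>
    rw [pow_zero, pow_one, pow_one] at h
    rw [zero_add, pow_one, IsLocalRing.mem_maximalIdeal, mem_nonunits_iff]
    intro hc
    exact hab ((hc.dvd_mul_left).1 h)
  | succ k ih =>
    obtain ⟨q, hq⟩ := h
    have hcoord : coord hx (c * a ^ p ^ (k + 1)) = coord hx (b ^ p ^ (k + 1) * q) := by rw [hq]
    rw [mul_comm c, pow_succ, pow_mul, pow_mul, coord_pow_mul, coord_pow_mul] at hcoord
    rw [← sum_coord hx c]
    refine Ideal.sum_mem _ fun e _ => Ideal.mul_mem_right _ _ ?_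
    have he := congrFun hcoord e
    simp only [Pi.smul_apply, smul_eq_mul] at he
    have hmem := ih (c := coord hx c e) ⟨coord hx q e, by rw [mul_comm, he]⟩
    have h1 := Ideal.pow_mem_pow hmem p
    rw [← pow_mul] at h1
    refine Ideal.pow_le_pow_right ?_ h1
    nlinarith

/-- A noetherian local domain with a `p`-basis is normal. -/
theorem isIntegrallyClosed_of_isPBasis [IsLocalRing A] [IsNoetherianRing A] [IsDomain A]
    (hx : IsPBasis p x) : IsIntegrallyClosed A := by
  rw [isIntegrallyClosed_iff (FractionRing A)]
  intro z hz
  -- `c` is a common denominator of all powers of `z`. The exponents `p ^ i` place it in every power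
  -- of `𝔪`, contradicting Krull's intersection theorem.
  obtain ⟨c, hc, hcz⟩ := hz.isAlmostIntegral
  obtain ⟨a, b, hb, rfl⟩ := IsFractionRing.div_surjective (A := A) z
  have hb0 : b ≠ 0 := nonZeroDivisors.ne_zero hb
  have hb0' : algebraMap A (FractionRing A) b ≠ 0 := by simpa using hb0
  by_cases hab : b ∣ a
  · obtain ⟨q, rfl⟩ := hab
    exact ⟨q, by rw [map_mul, mul_div_cancel_left₀ _ hb0']⟩
  · exfalso
    refine nonZeroDivisors.ne_zero hc ?_
    have hmem : c ∈ ⨅ i, IsLocalRing.maximalIdeal A ^ i := by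
      rw [Ideal.mem_iInf]
      intro i
      have : b ^ p ^ i ∣ c * a ^ p ^ i := by
        obtain ⟨q, hq⟩ := hcz (p ^ i)
        refine ⟨q, IsFractionRing.injective A (FractionRing A) ?_⟩
        rw [map_mul, map_mul, hq, Algebra.smul_def, map_pow, map_pow, div_pow]
        field_simp
      exact Ideal.pow_le_pow_right (Nat.le_succ i)
        (mem_maximalIdeal_pow_of_mul_pow_dvd hx hab i this)
    rwa [Ideal.iInf_pow_eq_bot_of_isLocalRing _ (IsLocalRing.maximalIdeal.isMaximal A).ne_top,
      Ideal.mem_bot] at hmem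

/-- In a noetherian normal local domain, an associated maximal ideal of a principal ideal is
principal. -/
theorem maximalIdeal_isPrincipal_of_mul_mem {R : Type*} [CommRing R] [IsLocalRing R]
    [IsNoetherianRing R] [IsDomain R] [IsIntegrallyClosed R] {y z : R} (hy : y ≠ 0)
    (hz : ¬ y ∣ z) (h : ∀ r ∈ IsLocalRing.maximalIdeal R, y ∣ r * z) :
    (IsLocalRing.maximalIdeal R).IsPrincipal := by
  have hz0 : z ≠ 0 := by rintro rfl; exact hz (dvd_zero _)
  -- `(z / y) 𝔪` is an ideal of `R`. If it is `R`, then `𝔪` is principal; otherwise `z / y` maps `𝔪`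
  -- into itself and is integral, so `y ∣ z` by normality.
  by_cases hex : ∃ t ∈ IsLocalRing.maximalIdeal R, ∃ c, IsUnit c ∧ t * z = y * c
  · obtain ⟨t, ht, c, hc, htc⟩ := hex
    obtain ⟨c', hc'⟩ := hc.exists_right_inv
    refine ⟨t, le_antisymm ?_ ((Ideal.span_singleton_le_iff_mem _).2 ht)⟩
    intro r hr
    obtain ⟨s, hs⟩ := h r hr
    refine Ideal.mem_span_singleton'.2 ⟨s * c', mul_right_cancel₀ hz0 ?_⟩
    linear_combination s * c' * htc - hs + s * y * hc'
  · exfalso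
    push Not at hex
    have hy' : algebraMap R (FractionRing R) y ≠ 0 := by simpa using hy
    by_cases hbot : IsLocalRing.maximalIdeal R = ⊥
    · have hu : IsUnit y := by
        by_contra hyu
        have : y ∈ IsLocalRing.maximalIdeal R := hyu
        rw [hbot] at this
        exact hy this
      exact hz hu.dvd
    have hint : IsIntegral R
        (algebraMap R (FractionRing R) z / algebraMap R (FractionRing R) y) := by
      let N : Submodule R (FractionRing R) :=
        Submodule.map (Algebra.linearMap R (FractionRing R)) (IsLocalRing.maximalIdeal R)
      refine isIntegral_of_smul_mem_submodule N ?_ ?_ _ ?_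
      · obtain ⟨t, ht, ht0⟩ := Submodule.exists_mem_ne_zero_of_ne_bot hbot
        refine Submodule.ne_bot_iff _ |>.2 ⟨algebraMap R (FractionRing R) t, ⟨t, ht, rfl⟩, ?_⟩
        simpa using ht0
      · exact Submodule.FG.map _ (IsNoetherian.noetherian _)
      · rintro _ ⟨r, hr, rfl⟩
        obtain ⟨c, hc⟩ := h r hr
        refine ⟨c, fun hcu => hex r hr c hcu hc, ?_⟩
        · rw [Algebra.linearMap_apply, Algebra.linearMap_apply, smul_eq_mul]
          have := congrArg (algebraMap R (FractionRing R)) hc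
          rw [map_mul, map_mul] at this
          field_simp
          rw [mul_comm, ← this, mul_comm]
    obtain ⟨c, hc⟩ := IsIntegrallyClosed.isIntegral_iff.1 hint
    refine hz ⟨c, IsFractionRing.injective R (FractionRing R) ?_⟩
    rw [map_mul, hc, mul_div_cancel₀ _ hy']

/-- Divisibility in a noetherian normal domain can be tested in codimension one. -/
theorem dvd_of_forall_ordAt_le [IsNoetherianRing A] [IsDomain A] [IsIntegrallyClosed A]
    {a b : A} (ha : a ≠ 0) (hb : b ≠ 0) (h : ∀ P : PrimeDivisor A, ordAt P b ≤ ordAt P a) :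
    b ∣ a := by
  by_contra hab
  have hne : (Ideal.Quotient.mk (Ideal.span {b}) a) ≠ 0 := by
    rwa [Ne, Ideal.Quotient.eq_zero_iff_mem, Ideal.mem_span_singleton]
  obtain ⟨P, hP, hle⟩ := exists_le_isAssociatedPrime_of_isNoetherianRing A _ hne
  obtain ⟨hPp, z, hz⟩ := isAssociatedPrime_iff.1 hP
  obtain ⟨z, rfl⟩ := Ideal.Quotient.mk_surjective z
  have hmem (r z : A) : r ∈ (⊥ : Submodule A (A ⧸ Ideal.span {b})).colon
      {Ideal.Quotient.mk (Ideal.span {b}) z} ↔ b ∣ r * z := by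
    rw [Submodule.mem_colon_singleton, Submodule.mem_bot, ← Ideal.mem_span_singleton,
      ← Ideal.Quotient.eq_zero_iff_mem, map_mul]
    rfl
  let R := Localization.AtPrime P
  have hinj : Function.Injective (algebraMap A R) :=
    IsLocalization.injective R P.primeCompl_le_nonZeroDivisors
  have hR : IsIntegrallyClosed R :=
    isIntegrallyClosed_of_isLocalization R P.primeCompl P.primeCompl_le_nonZeroDivisors
  have hbR : algebraMap A R b ≠ 0 := by rwa [Ne, map_eq_zero_iff _ hinj]
  have haR : algebraMap A R a ≠ 0 := by rwa [Ne, map_eq_zero_iff _ hinj]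
  have hdvd {c : A} (hc : algebraMap A R b ∣ algebraMap A R c) : ∃ t ∉ P, b ∣ t * c := by
    obtain ⟨q, hq⟩ := hc
    obtain ⟨⟨q, t⟩, rfl⟩ := IsLocalization.mk'_surjective P.primeCompl q
    refine ⟨t, t.2, q, hinj ?_⟩
    rw [map_mul, map_mul, hq, mul_comm, mul_assoc, IsLocalization.mk'_spec]
  have hzR : ¬ algebraMap A R b ∣ algebraMap A R z := by
    intro hc
    obtain ⟨t, ht, htz⟩ := hdvd hc
    exact ht (hz ▸ (hmem t z).2 htz)
  have hPR : IsLocalRing.maximalIdeal R = P.map (algebraMap A R) :=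
    (Localization.AtPrime.map_eq_maximalIdeal).symm
  have hprin : (IsLocalRing.maximalIdeal R).IsPrincipal := by
    refine maximalIdeal_isPrincipal_of_mul_mem hbR hzR ?_
    intro r hr
    rw [hPR] at hr
    refine Submodule.span_induction
      (p := fun r _ => algebraMap A R b ∣ r * algebraMap A R z) ?_ ?_ ?_ ?_ hr
    · rintro _ ⟨r, hr, rfl⟩
      rw [← map_mul]
      rw [SetLike.mem_coe, hz] at hr
      exact map_dvd _ ((hmem r z).1 hr)
    · rw [zero_mul]; exact dvd_zero _
    · intro r s _ _ hr hs
      rw [add_mul]; exact dvd_add hr hs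
    · intro c r _ hr
      rw [smul_eq_mul, mul_assoc]; exact hr.mul_left _
  have hfield : ¬ IsField R := by
    intro hF
    rw [IsLocalRing.isField_iff_maximalIdeal_eq, hPR] at hF
    have hbP : b ∈ P := by
      rw [hz, hmem]; exact dvd_mul_right _ _
    have := Ideal.mem_map_of_mem (algebraMap A R) hbP
    rw [hF] at this
    exact hbR this
  have hdvr : IsDiscreteValuationRing R :=
    ((IsDiscreteValuationRing.TFAE R hfield).out 0 4).2 hprin
  have hht : P.height = 1 := by
    have h1 := IsPrincipalIdealRing.ringKrullDim_eq_one R hfield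
    rw [IsLocalization.AtPrime.ringKrullDim_eq_height P R] at h1
    exact_mod_cast h1
  have hord := h ⟨⟨P, hPp⟩, hht⟩
  have hta : Ring.ord R (algebraMap A R a) ≠ ⊤ :=
    Ring.ord_ne_top (mem_nonZeroDivisors_of_ne_zero haR)
  have hle' : Ring.ord R (algebraMap A R b) ≤ Ring.ord R (algebraMap A R a) := by
    have htb : Ring.ord R (algebraMap A R b) ≠ ⊤ :=
      Ring.ord_ne_top (mem_nonZeroDivisors_of_ne_zero hbR)
    rw [← ENat.natCast_toNat hta, ← ENat.natCast_toNat htb, Nat.cast_le]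
    exact Int.ofNat_le.1 hord
  -- Now `b ∣ a` in `A_P`, so `b ∣ t a` for some `t ∉ P`; but `P` contains the annihilator of `a`
  -- modulo `b`.
  rw [Ring.ord_eq_addVal, Ring.ord_eq_addVal, IsDiscreteValuationRing.addVal_le_iff_dvd] at hle'
  obtain ⟨t, ht, hta⟩ := hdvd hle'
  exact ht (hle ((hmem t a).2 hta))

theorem ordAt_mul [IsNoetherianRing A] [IsDomain A] (P : PrimeDivisor A) {a b : A}
    (ha : a ≠ 0) (hb : b ≠ 0) : ordAt P (a * b) = ordAt P a + ordAt P b := by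
  let R := Localization.AtPrime P.1.asIdeal
  have hinj : Function.Injective (algebraMap A R) :=
    IsLocalization.injective R P.1.asIdeal.primeCompl_le_nonZeroDivisors
  have hdim : Ring.KrullDimLE 1 R := by
    rw [Ring.krullDimLE_iff, IsLocalization.AtPrime.ringKrullDim_eq_height P.1.asIdeal R, P.2]
    exact le_rfl
  have hreg {c : A} (hc : c ≠ 0) : algebraMap A R c ∈ nonZeroDivisors R :=
    mem_nonZeroDivisors_of_ne_zero (by rwa [Ne, map_eq_zero_iff _ hinj])
  rw [ordAt, map_mul, Ring.ord_mul R (hreg hb), ENat.toNat_add (Ring.ord_ne_top (hreg ha))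
    (Ring.ord_ne_top (hreg hb))]
  push_cast
  rfl

theorem ordAt_pow [IsNoetherianRing A] [IsDomain A] (P : PrimeDivisor A) {a : A}
    (ha : a ≠ 0) (n : ℕ) : ordAt P (a ^ n) = n * ordAt P a := by
  induction n with
  | zero =>
    have := ordAt_mul P (one_ne_zero (α := A)) (one_ne_zero (α := A))
    rw [mul_one] at this
    rw [pow_zero]
    push_cast
    linarith
  | succ n ih =>
    rw [pow_succ, ordAt_mul P (pow_ne_zero n ha) ha, ih]
    push_cast
    ring

theorem ordAt_nonneg (P : PrimeDivisor A) (a : A) : 0 ≤ ordAt P a := Int.natCast_nonneg _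

theorem dvd_iff_forall_ordAt_le [IsNoetherianRing A] [IsDomain A] [IsIntegrallyClosed A]
    {a b : A} (ha : a ≠ 0) (hb : b ≠ 0) :
    b ∣ a ↔ ∀ P : PrimeDivisor A, ordAt P b ≤ ordAt P a := by
  refine ⟨?_, dvd_of_forall_ordAt_le ha hb⟩
  rintro ⟨c, rfl⟩ P
  have hc : c ≠ 0 := by rintro rfl; exact ha (mul_zero _)
  rw [ordAt_mul P hb hc]
  linarith [ordAt_nonneg P c]

/-- Sections of `p^i · p · (1 - 2 / p^n) div(f)`, in terms of divisibility. -/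
theorem mem_sections_iff [IsNoetherianRing A] [IsDomain A] [IsIntegrallyClosed A]
    {f : A} (hf : f ≠ 0) {n i : ℕ} (hi : i < n) (a : FractionRing A) :
    a ∈ sections ((p : ℚ) ^ i • (p : ℚ) • nsDivisor p f n) ↔
      ∃ c : A, (a * algebraMap A (FractionRing A) f ^ p ^ (i + 1)) ^ p ^ (n - 1 - i) =
        algebraMap A (FractionRing A) (f ^ 2 * c) := by
  have hp := (Fact.out : p.Prime)
  rcases eq_or_ne a 0 with rfl | ha
  · refine ⟨fun _ => ⟨0, ?_⟩, fun _ => Or.inl rfl⟩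
    rw [zero_mul, mul_zero, map_zero, zero_pow (pow_ne_zero _ hp.ne_zero)]
  let K := FractionRing A
  have hspec := IsLocalization.sec_spec (nonZeroDivisors A) a
  set r := (IsLocalization.sec (nonZeroDivisors A) a).1 with hr
  set s := ((IsLocalization.sec (nonZeroDivisors A) a).2 : A) with hs
  have hs0 : s ≠ 0 := nonZeroDivisors.ne_zero (IsLocalization.sec (nonZeroDivisors A) a).2.2
  have hsK : algebraMap A K s ≠ 0 := by simpa using hs0
  have hr0 : r ≠ 0 := by
    intro h
    rw [h, map_zero] at hspec
    exact (mul_ne_zero ha hsK) hspec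
  -- The power that clears the denominator: `p ^ (n-1-i) · p ^ (i+1) · (1 - 2 / p ^ n) = p ^ n - 2`.
  set N := p ^ (n - 1 - i) with hN
  set M := p ^ (i + 1) with hM
  have hMN : M * N = p ^ n := by
    rw [hM, hN, ← pow_add]
    congr 1
    omega
  have hdvd : (∃ c : A, (a * algebraMap A K f ^ M) ^ N = algebraMap A K (f ^ 2 * c)) ↔
      f ^ 2 * s ^ N ∣ (r * f ^ M) ^ N := by
    refine exists_congr fun c => ?_
    rw [← (IsFractionRing.injective A K).eq_iff (a := (r * f ^ M) ^ N)]
    simp only [map_mul, map_pow]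
    rw [← hspec, mul_right_comm (a : K), mul_pow _ (algebraMap A K s),
      mul_right_comm _ _ (algebraMap A K c)]
    exact (mul_left_inj' (pow_ne_zero _ hsK)).symm
  have hord : a ∈ sections ((p : ℚ) ^ i • (p : ℚ) • nsDivisor p f n) ↔
      ∀ P : PrimeDivisor A, ordAt P (f ^ 2 * s ^ N) ≤ ordAt P ((r * f ^ M) ^ N) := by
    have h1 : a ∈ sections ((p : ℚ) ^ i • (p : ℚ) • nsDivisor p f n) ↔
        ∀ P : PrimeDivisor A, 0 ≤ ((ordAt P r - ordAt P s : ℤ) : ℚ) +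
          (p : ℚ) ^ i * (p * ((1 - 2 / (p : ℚ) ^ n) * (ordAt P f : ℚ))) :=
      ⟨fun h => h.resolve_left ha, fun h => Or.inr h⟩
    rw [h1]
    refine forall_congr' fun P => ?_
    rw [ordAt_mul P (pow_ne_zero _ hf) (pow_ne_zero _ hs0), ordAt_pow P hf, ordAt_pow P hs0,
      ordAt_pow P (mul_ne_zero hr0 (pow_ne_zero _ hf)), ordAt_mul P hr0 (pow_ne_zero _ hf),
      ordAt_pow P hf]
    have hNpos : (0 : ℚ) < N := by exact_mod_cast pow_pos hp.pos _
    have hpn : (p : ℚ) ^ n ≠ 0 := pow_ne_zero _ (by exact_mod_cast hp.ne_zero)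
    have hMN' : (M : ℚ) * N = (p : ℚ) ^ n := by exact_mod_cast hMN
    have hMp : (M : ℚ) = (p : ℚ) ^ i * p := by rw [hM]; push_cast; ring
    rw [← mul_nonneg_iff_of_pos_left hNpos, ← sub_nonneg (b := _ + _),
      ← Int.cast_le (R := ℚ), Int.cast_zero]
    refine iff_of_eq (congrArg _ ?_)
    push_cast
    have h2 : (N : ℚ) * ((p : ℚ) ^ i * (p * ((1 - 2 / (p : ℚ) ^ n) * (ordAt P f : ℚ)))) =
        (M * N - 2) * ordAt P f := by
      rw [← mul_assoc _ (p : ℚ), ← hMp, hMN']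
      field_simp
      rw [← hMN']
      ring
    rw [mul_add, h2]
    ring
  rw [hord, hdvd, dvd_iff_forall_ordAt_le
    (pow_ne_zero _ (mul_ne_zero hr0 (pow_ne_zero _ hf)))
    (mul_ne_zero (pow_ne_zero _ hf) (pow_ne_zero _ hs0))]

end Normal

/-! ### Components of twisted Witt vectors -/

section Components

variable {p : ℕ} [Fact p.Prime] {A : Type*} [CommRing A]

theorem coeff_succ_teichmuller_add_verschiebung (a : A) (w : WittVector p A) (i : ℕ) :
    (teichmuller p a + verschiebung w).coeff (i + 1) = w.coeff i := by
  rw [WittVector.coeff_add_of_disjoint, WittVector.teichmuller_coeff_pos _ _ _ i.succ_pos, zero_add,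
    WittVector.verschiebung_coeff_add_one]
  intro j
  cases j with
  | zero => exact Or.inr (WittVector.verschiebung_coeff_zero _)
  | succ j => exact Or.inl (WittVector.teichmuller_coeff_pos _ _ _ j.succ_pos)

variable [CharP A p]

theorem teichmuller_mul_eq (a : A) (w : WittVector p A) : teichmuller p a * w =
    teichmuller p (a * w.coeff 0) + verschiebung (teichmuller p (a ^ p) * w.shift 1) := by
  conv_lhs => rw [eq_teichmuller_add_verschiebung w]
  rw [mul_add, ← map_mul, verschiebung_mul, frobenius_teichmuller]

theorem coeff_teichmuller_mul (a : A) (w : WittVector p A) (i : ℕ) :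
    (teichmuller p a * w).coeff i = a ^ p ^ i * w.coeff i := by
  induction i generalizing a w with
  | zero => rw [coeff_zero_mul, WittVector.teichmuller_coeff_zero, pow_zero, pow_one]
  | succ i ih =>
    rw [teichmuller_mul_eq, coeff_succ_teichmuller_add_verschiebung, ih, ← pow_mul, ← pow_succ',
      WittVector.shift_coeff, add_comm 1]

/-- The tail of `[f] w` is a multiple of `[f ^ p]`, hence lies in the ideal one level down; so the
recursive and componentwise descriptions agree. -/
theorem mem_twistIdeal_iff {f : A} {m : ℕ} {y : WittVector p A} :
    y ∈ twistIdeal p f m ↔ (∀ i < m, f ∣ y.coeff i) ∧ f ^ 2 ∣ y.coeff m := by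
  induction m generalizing y with
  | zero =>
    rw [mem_twistIdeal_zero]
    exact ⟨fun h => ⟨fun i hi => absurd hi (Nat.not_lt_zero i), h⟩, fun h => h.2⟩
  | succ m ih =>
    have key : y ∈ twistIdeal p f (m + 1) ↔ f ∣ y.coeff 0 ∧ y.shift 1 ∈ twistIdeal p f m := by
      constructor
      · rintro ⟨w, z, hz, rfl⟩
        rw [teichmuller_mul_eq, add_assoc, ← map_add]
        refine ⟨?_, ?_⟩
        · rw [coeff_zero_add, WittVector.teichmuller_coeff_zero,
            WittVector.verschiebung_coeff_zero, add_zero]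
          exact dvd_mul_right _ _
        · have : (teichmuller p (f * w.coeff 0) + verschiebung
              (teichmuller p (f ^ p) * w.shift 1 + z)).shift 1 =
              teichmuller p (f ^ p) * w.shift 1 + z := by
            ext i
            rw [WittVector.shift_coeff, add_comm 1, coeff_succ_teichmuller_add_verschiebung]
          rw [this]
          exact add_mem (teichmuller_pow_mul_mem _) hz
      · rintro ⟨⟨c, hc⟩, hz⟩
        refine ⟨teichmuller p c, y.shift 1, hz, ?_⟩
        rw [← map_mul, ← hc, ← eq_teichmuller_add_verschiebung]
    rw [key, ih]
    simp only [WittVector.shift_coeff, add_comm 1]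
    constructor
    · rintro ⟨h0, h1, h2⟩
      refine ⟨fun i hi => ?_, h2⟩
      cases i with
      | zero => exact h0
      | succ i => exact h1 i (by omega)
    · rintro ⟨h1, h2⟩
      exact ⟨h1 0 (by omega), fun i hi => h1 (i + 1) (by omega), h2⟩

/-- If there is a dual element with value `1` at `[f ^ p]`, then `A / f A` is reduced. -/
theorem IsDual.dvd_of_dvd_pow {f : A} {m : ℕ} {ψ : WittVector p A → A} (h : IsDual f (m + 1) ψ)
    (h1 : ψ (teichmuller p (f ^ p)) = 1) {a : A} (ha : f ∣ a ^ p) : f ∣ a := by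
  obtain ⟨b, hb⟩ := ha
  have hmem1 : teichmuller p (f ^ p) ∈ twistIdeal p f (m + 1) := by
    simpa using teichmuller_pow_mul_mem (f := f) (n := m + 1) (1 : WittVector p A)
  have hmem2 := teichmuller_mul_mem (p := p) (f := f) (n := m) (teichmuller p b)
  -- With `a ^ p = f b`, evaluating `ψ` at `[a ^ p f ^ p] = [f ^ p] [f b]` in two ways gives `a = f
  -- ψ([f b])`.
  have e1 := h.frobenius_mul (teichmuller p a) _ hmem1
  have e2 := h.frobenius_mul (teichmuller p f) _ hmem2
  rw [WittVector.teichmuller_coeff_zero, frobenius_teichmuller] at e1 e2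
  rw [h1, mul_one, hb, ← map_mul] at e1
  rw [← map_mul, ← map_mul] at e2
  rw [← e1, mul_comm, e2]
  exact dvd_mul_right _ _

theorem IsDual.dvd_of_dvd_pow_pow {f : A} {m : ℕ} {ψ : WittVector p A → A}
    (h : IsDual f (m + 1) ψ) (h1 : ψ (teichmuller p (f ^ p)) = 1) {a : A} (k : ℕ)
    (ha : f ∣ a ^ p ^ k) : f ∣ a := by
  induction k with
  | zero => simpa using ha
  | succ k ih =>
    rw [pow_succ, pow_mul] at ha
    exact ih (h.dvd_of_dvd_pow h1 ha)

end Components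

/-! ### Quasi-`F`-splittings and dual elements -/

section Splitting

variable {p : ℕ} [Fact p.Prime] {A : Type*} [CommRing A] [CharP A p]

theorem Along.of_symm_smul {R S M : Type*} [CommRing R] [CommRing S] (φ : R →+* S)
    [AddCommGroup M] [Module S M] (r : R) (m : Along φ M) :
    (Along.of φ).symm (r • m) = φ r • (Along.of φ).symm m := rfl

/-- The pair `(A, D)` is quasi-`F`-split if and only if there is a homomorphism
`F_* W_n(A)(pD) → A` with value `1` at `1`. -/
theorem isQuasiFSplit_iff {n : ℕ} [NeZero n] (D : QDivisor A) (hD : 0 ≤ (p : ℚ) • D) :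
    IsQuasiFSplit p n D hD ↔
      ∃ ψ : FWTwist p n ((p : ℚ) • D) →ₗ[W p n A] Along (res p n A) A,
        ψ ⟨_, one_mem_FWTwist p n hD⟩ = Along.of (res p n A) 1 := by
  have hF1 : frobeniusTwist p n ((p : ℚ) • D) hD 1 = ⟨_, one_mem_FWTwist p n hD⟩ :=
    Subtype.ext (congrArg (Along.of (wittFrobenius p n A)) (map_one (wittFrobenius p n A)))
  have hR1 : resLinear p n A 1 = Along.of (res p n A) 1 :=
    congrArg (Along.of (res p n A)) (map_one (res p n A))
  constructor
  · intro h
    obtain ⟨Ψ, hΨ⟩ := h 1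
    refine ⟨(Ψ.comp (Submodule.mkQ _)).comp (LinearMap.inl _ _ _), ?_⟩
    have heq : (Submodule.mkQ (LinearMap.range ((frobeniusTwist p n ((p : ℚ) • D) hD).prod
        (-(resLinear p n A))))) (⟨_, one_mem_FWTwist p n hD⟩, 0) =
        toQ p n D hD (Along.of (res p n A) 1) := by
      change Submodule.Quotient.mk _ = Submodule.Quotient.mk _
      rw [Submodule.Quotient.eq]
      refine ⟨1, ?_⟩
      refine Prod.ext ?_ ?_
      · exact hF1.trans (sub_zero _).symm
      · exact (congrArg Neg.neg hR1).trans (zero_sub _).symm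
    exact (congrArg Ψ heq).trans ((AddEquiv.symm_apply_eq _).1 hΨ)
  · rintro ⟨ψ, hψ⟩ b
    have hψF (w : W p n A) : ψ (frobeniusTwist p n ((p : ℚ) • D) hD w) = resLinear p n A w := by
      have h1 : frobeniusTwist p n ((p : ℚ) • D) hD w = w • ⟨_, one_mem_FWTwist p n hD⟩ := by
        rw [← hF1, ← map_smul, smul_eq_mul, mul_one]
      rw [h1, map_smul, hψ, ← hR1, ← map_smul, smul_eq_mul, mul_one]
    let Ψ : Q p n D hD →ₗ[W p n A] Along (res p n A) A :=
      Submodule.liftQ _ (ψ.coprod LinearMap.id) (by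
        rintro _ ⟨w, rfl⟩
        change ψ (frobeniusTwist p n ((p : ℚ) • D) hD w) + -(resLinear p n A w) = 0
        rw [hψF, add_neg_cancel])
    have hΨ : Ψ (toQ p n D hD (Along.of (res p n A) 1)) = Along.of (res p n A) 1 := by
      change ψ 0 + Along.of (res p n A) 1 = _
      rw [map_zero, zero_add]
    refine ⟨WittVector.truncate n (teichmuller p b) • Ψ, ?_⟩
    beta_reduce
    rw [LinearMap.smul_apply, hΨ, Along.of_symm_smul, AddEquiv.symm_apply_apply, smul_eq_mul,
      mul_one, res_apply, WittVector.coeff_truncate]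
    exact WittVector.teichmuller_coeff_zero _ _

variable [IsDomain A]

instance : CharP (FractionRing A) p :=
  charP_of_injective_algebraMap (IsFractionRing.injective A (FractionRing A)) p

/-! ### Clearing poles by `[f ^ p]`. -/

/-- The additive map `w ↦ F_*([f ^ (-p)] w)` from `W(A)` to `F_* W_n(Frac A)`. -/
def untwist (n : ℕ) (f : A) : WittVector p A →+ FWFrac p n A where
  toFun w := Along.of (wittFrobenius p n A) (WittVector.truncate n
    (teichmuller p ((algebraMap A (FractionRing A) f ^ p)⁻¹) *
      WittVector.map (algebraMap A (FractionRing A)) w))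
  map_zero' := by simp
  map_add' v w := by simp only [map_add, mul_add]

theorem untwist_apply (n : ℕ) (f : A) (w : WittVector p A) :
    untwist n f w = Along.of (wittFrobenius p n A) (WittVector.truncate n
      (teichmuller p ((algebraMap A (FractionRing A) f ^ p)⁻¹) *
        WittVector.map (algebraMap A (FractionRing A)) w)) := rfl

theorem coeff_untwist (n : ℕ) (f : A) (w : WittVector p A) (i : Fin n) :
    ((Along.of (wittFrobenius p n A)).symm (untwist n f w)).coeff i =
      ((algebraMap A (FractionRing A) f ^ p)⁻¹) ^ p ^ (i : ℕ) *
        algebraMap A (FractionRing A) (w.coeff i) := by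
  rw [untwist_apply, AddEquiv.symm_apply_apply, WittVector.coeff_truncate,
    coeff_teichmuller_mul, WittVector.map_coeff]

theorem coeff_untwist_mul {f : A} (hf : f ≠ 0) (n : ℕ) (w : WittVector p A) (i : Fin n) :
    ((Along.of (wittFrobenius p n A)).symm (untwist n f w)).coeff i *
      algebraMap A (FractionRing A) f ^ p ^ ((i : ℕ) + 1) =
        algebraMap A (FractionRing A) (w.coeff i) := by
  have hf' : algebraMap A (FractionRing A) f ≠ 0 := by simpa using hf
  rw [coeff_untwist, pow_succ', pow_mul, mul_right_comm, ← mul_pow,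
    inv_mul_cancel₀ (pow_ne_zero _ hf'), one_pow, one_mul]

theorem wittFrobenius_truncate (n : ℕ) (w : WittVector p A) :
    wittFrobenius p n A (WittVector.truncate n w) = WittVector.truncate n
      (WittVector.map (algebraMap A (FractionRing A)) (WittVector.frobenius w)) := by
  ext i
  rw [wittFrobenius, coeff_wittMap, WittVector.coeff_truncate, WittVector.coeff_truncate,
    WittVector.map_coeff, WittVector.coeff_frobenius_charP]
  rfl

theorem truncate_smul_untwist (n : ℕ) (f : A) (v w : WittVector p A) :
    WittVector.truncate n v • untwist n f w = untwist n f (WittVector.frobenius v * w) := by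
  rw [untwist_apply, untwist_apply, Along.smul_of, wittFrobenius_truncate, smul_eq_mul,
    ← map_mul, map_mul (WittVector.map _), mul_left_comm]

theorem untwist_teichmuller {f : A} (hf : f ≠ 0) (n : ℕ) :
    untwist n f (teichmuller p (f ^ p)) = Along.of (wittFrobenius p n A) 1 := by
  have hf' : algebraMap A (FractionRing A) f ≠ 0 := by simpa using hf
  rw [untwist_apply, WittVector.map_teichmuller, ← map_mul, map_pow,
    inv_mul_cancel₀ (pow_ne_zero _ hf'), map_one, map_one]

theorem mem_ker_truncate_of_untwist_eq {f : A} (hf : f ≠ 0) {n : ℕ} {v w : WittVector p A}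
    (h : untwist n f v = untwist n f w) :
    v - w ∈ RingHom.ker (WittVector.truncate (p := p) (R := A) n) := by
  rw [RingHom.mem_ker, map_sub, sub_eq_zero]
  ext i
  rw [WittVector.coeff_truncate, WittVector.coeff_truncate]
  apply IsFractionRing.injective A (FractionRing A)
  rw [← coeff_untwist_mul hf, ← coeff_untwist_mul hf, h]

theorem untwist_eq_zero {f : A} {n : ℕ} {w : WittVector p A}
    (h : w ∈ RingHom.ker (WittVector.truncate (p := p) (R := A) n)) : untwist n f w = 0 := by
  apply (Along.of (wittFrobenius p n A)).symm.injective
  ext i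
  rw [coeff_untwist, (WittVector.mem_ker_truncate n w).1 h i i.2, map_zero, mul_zero, map_zero,
    TruncatedWittVector.coeff_zero]

variable [IsNoetherianRing A] [IsIntegrallyClosed A] {f : A} {m : ℕ}

/-- This inclusion holds for every `f ≠ 0`: below the top component the clearing exponent is at
least `p ≥ 2`, so divisibility by `f` suffices. -/
theorem untwist_mem (hf : f ≠ 0) {y : WittVector p A} (hy : y ∈ twistIdeal p f m) :
    untwist (m + 1) f y ∈ FWTwist p (m + 1) ((p : ℚ) • nsDivisor p f (m + 1)) := by
  have hp := (Fact.out : p.Prime).two_le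
  apply Submodule.subset_span
  intro i
  rw [mem_sections_iff hf i.2, coeff_untwist_mul hf]
  obtain ⟨h1, h2⟩ := mem_twistIdeal_iff.1 hy
  have hdvd : f ^ 2 ∣ y.coeff i ^ p ^ (m + 1 - 1 - i) := by
    rcases (Nat.lt_succ_iff.1 i.2).lt_or_eq with hi | hi
    · refine dvd_trans ?_ (pow_dvd_pow_of_dvd (h1 i hi) _)
      refine pow_dvd_pow f (hp.trans (Nat.le_self_pow ?_ p))
      omega
    · rw [hi, show m + 1 - 1 - m = 0 by omega, pow_zero, pow_one]
      exact h2
  obtain ⟨c, hc⟩ := hdvd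
  exact ⟨c, by rw [← hc, map_pow]⟩

/-- Every twisted Witt vector of the pair is `[f ^ (-p)]` times an element of the twisted ideal,
if the pair splits. -/
theorem exists_untwist_eq (hf : f ≠ 0) {ψ : WittVector p A → A} (hψ : IsDual f m ψ)
    (h1 : ψ (teichmuller p (f ^ p)) = 1) {a : FWFrac p (m + 1) A}
    (ha : a ∈ FWTwist p (m + 1) ((p : ℚ) • nsDivisor p f (m + 1))) :
    ∃ y ∈ twistIdeal p f m, untwist (m + 1) f y = a := by
  have hp := (Fact.out : p.Prime)
  have hf' : algebraMap A (FractionRing A) f ≠ 0 := by simpa using hf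
  refine Submodule.span_induction
    (p := fun a _ => ∃ y ∈ twistIdeal p f m, untwist (m + 1) f y = a) ?_ ?_ ?_ ?_ ha
  · intro a ha
    have hex (i : Fin (m + 1)) : ∃ y : A, f ^ 2 ∣ y ^ p ^ (m + 1 - 1 - (i : ℕ)) ∧
        ((Along.of (wittFrobenius p (m + 1) A)).symm a).coeff i *
          algebraMap A (FractionRing A) f ^ p ^ ((i : ℕ) + 1) =
            algebraMap A (FractionRing A) y := by
      -- A power of the untwisted component lies in `A`, hence so does the component, by normality.
      obtain ⟨c, hc⟩ := (mem_sections_iff hf i.2 _).1 (ha i)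
      have hint := IsIntegrallyClosed.isIntegral_iff.2 ⟨_, hc.symm⟩
      obtain ⟨y, hy⟩ := IsIntegrallyClosed.isIntegral_iff.1
        (hint.of_pow (pow_pos hp.pos _))
      refine ⟨y, ⟨c, IsFractionRing.injective A (FractionRing A) ?_⟩, hy.symm⟩
      rw [← hc, map_pow, hy]
    choose c hc1 hc2 using hex
    let y : WittVector p A := WittVector.mk p fun i => if h : i < m + 1 then c ⟨i, h⟩ else 0
    have hy (i : Fin (m + 1)) : y.coeff i = c i := dif_pos i.2
    refine ⟨y, mem_twistIdeal_iff.2 ⟨?_, ?_⟩, ?_⟩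
    · intro i hi
      have := hc1 ⟨i, by omega⟩
      rw [hy ⟨i, by omega⟩]
      -- Components below the top exist only for `m ≥ 1`, where `ψ` forces `A / f A` to be reduced.
      obtain ⟨k, rfl⟩ : ∃ k, m = k + 1 := ⟨m - 1, by omega⟩
      exact hψ.dvd_of_dvd_pow_pow h1 _ ((dvd_pow_self f two_ne_zero).trans this)
    · have := hc1 (Fin.last m)
      rw [Fin.val_last, show m + 1 - 1 - m = 0 by omega, pow_zero, pow_one] at this
      exact (hy (Fin.last m)).symm ▸ this
    · apply (Along.of (wittFrobenius p (m + 1) A)).symm.injective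
      ext i
      have h2 := coeff_untwist_mul hf (m + 1) y i
      rw [hy, ← hc2] at h2
      exact mul_right_cancel₀ (pow_ne_zero _ hf') h2
  · exact ⟨0, zero_mem _, map_zero _⟩
  · rintro _ _ - - ⟨y, hy, rfl⟩ ⟨z, hz, rfl⟩
    exact ⟨y + z, add_mem hy hz, map_add _ _ _⟩
  · rintro w _ - ⟨y, hy, rfl⟩
    obtain ⟨w, rfl⟩ := WittVector.truncate_surjective p (m + 1) A w
    exact ⟨_, Ideal.mul_mem_left _ (WittVector.frobenius w) hy,
      (truncate_smul_untwist _ _ _ _).symm⟩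

/-- A splitting is pulled back along the inclusion of `untwist_mem`, valid for all `f ≠ 0`.
Conversely, a dual element with value `1` makes that inclusion an equality, so it descends to the
twisted module. -/
theorem isQuasiFSplit_iff_exists_isDual (hf : f ≠ 0)
    (hD : 0 ≤ (p : ℚ) • nsDivisor p f (m + 1)) :
    IsQuasiFSplit p (m + 1) (nsDivisor p f (m + 1)) hD ↔
      ∃ ψ : WittVector p A → A, IsDual f m ψ ∧ ψ (teichmuller p (f ^ p)) = 1 := by
  rw [isQuasiFSplit_iff]
  constructor
  · rintro ⟨ψ, hψ⟩
    classical
    let χ : WittVector p A → A := fun y =>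
      if h : untwist (m + 1) f y ∈ FWTwist p (m + 1) ((p : ℚ) • nsDivisor p f (m + 1)) then
        (Along.of (res p (m + 1) A)).symm (ψ ⟨_, h⟩) else 0
    have hχ {y : WittVector p A}
        (h : untwist (m + 1) f y ∈ FWTwist p (m + 1) ((p : ℚ) • nsDivisor p f (m + 1))) :
        χ y = (Along.of (res p (m + 1) A)).symm (ψ ⟨_, h⟩) := dif_pos h
    refine ⟨χ, ⟨?_, ?_, ?_⟩, ?_⟩
    · intro y hy z hz
      rw [hχ (untwist_mem hf (add_mem hy hz)), hχ (untwist_mem hf hy), hχ (untwist_mem hf hz),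
        ← map_add, ← map_add]
      congr 2
      exact Subtype.ext (map_add _ _ _)
    · intro w y hy
      rw [hχ (untwist_mem hf (Ideal.mul_mem_left _ _ hy)), hχ (untwist_mem hf hy)]
      have h1 : (⟨_, untwist_mem hf (Ideal.mul_mem_left _ (WittVector.frobenius w) hy)⟩ :
          FWTwist p (m + 1) ((p : ℚ) • nsDivisor p f (m + 1))) =
          WittVector.truncate (m + 1) w • ⟨_, untwist_mem hf hy⟩ :=
        Subtype.ext (truncate_smul_untwist _ _ _ _).symm
      rw [h1, map_smul, Along.of_symm_smul, res_apply, WittVector.coeff_truncate, smul_eq_mul]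
    · intro y hy
      have h0 := untwist_eq_zero (f := f) hy
      have hmem : untwist (m + 1) f y ∈ FWTwist p (m + 1) ((p : ℚ) • nsDivisor p f (m + 1)) := by
        rw [h0]; exact zero_mem _
      rw [hχ hmem, show (⟨_, hmem⟩ : FWTwist p (m + 1) ((p : ℚ) • nsDivisor p f (m + 1))) = 0 from
        Subtype.ext h0, map_zero, map_zero]
    · have h0 := untwist_teichmuller (p := p) hf (m + 1)
      have hmem : untwist (m + 1) f (teichmuller p (f ^ p)) ∈
          FWTwist p (m + 1) ((p : ℚ) • nsDivisor p f (m + 1)) := by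
        rw [h0]; exact one_mem_FWTwist p (m + 1) hD
      rw [hχ hmem, show (⟨_, hmem⟩ : FWTwist p (m + 1) ((p : ℚ) • nsDivisor p f (m + 1))) =
        ⟨_, one_mem_FWTwist p (m + 1) hD⟩ from Subtype.ext h0, hψ, AddEquiv.symm_apply_apply]
  · rintro ⟨ψ, hψ, h1⟩
    have hex (a : FWTwist p (m + 1) ((p : ℚ) • nsDivisor p f (m + 1))) :
        ∃ y ∈ twistIdeal p f m, untwist (m + 1) f y = a := exists_untwist_eq hf hψ h1 a.2
    choose c hc hca using hex
    have huniq {a : FWTwist p (m + 1) ((p : ℚ) • nsDivisor p f (m + 1))} {y : WittVector p A}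
        (hy : y ∈ twistIdeal p f m) (hya : untwist (m + 1) f y = a) : ψ (c a) = ψ y := by
      have hk := mem_ker_truncate_of_untwist_eq hf ((hca a).trans hya.symm)
      have := hψ.add y hy _ (mem_twistIdeal_of_mem_ker_truncate hk)
      rwa [hψ.trunc _ hk, add_zero, add_sub_cancel] at this
    refine ⟨⟨⟨fun a => Along.of (res p (m + 1) A) (ψ (c a)), ?_⟩, ?_⟩, ?_⟩
    · intro a b
      rw [← map_add, ← hψ.add _ (hc a) _ (hc b)]
      refine congrArg _ (huniq (add_mem (hc a) (hc b)) ?_)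
      rw [map_add, hca, hca]
      rfl
    · intro w a
      obtain ⟨w, rfl⟩ := WittVector.truncate_surjective p (m + 1) A w
      change Along.of _ (ψ (c (WittVector.truncate (m + 1) w • a))) =
        WittVector.truncate (m + 1) w • Along.of (res p (m + 1) A) (ψ (c a))
      rw [huniq (a := WittVector.truncate (m + 1) w • a)
        (Ideal.mul_mem_left _ (WittVector.frobenius w) (hc a))
        (by rw [← truncate_smul_untwist, hca]; rfl), hψ.frobenius_mul _ _ (hc a),
        Along.smul_of, res_apply, WittVector.coeff_truncate]
      rfl
    · change Along.of (res p (m + 1) A) (ψ (c _)) = _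
      have hmem : teichmuller p (f ^ p) ∈ twistIdeal p f m := by
        simpa using teichmuller_pow_mul_mem (f := f) (n := m) (1 : WittVector p A)
      rw [huniq hmem (untwist_teichmuller hf _), h1]

end Splitting

/-- The Fedder type criterion at level `n`. -/
theorem isQuasiFSplit_nsDivisor_iff {p : ℕ} [Fact p.Prime] {A : Type*} [CommRing A] [CharP A p]
    [IsLocalRing A] [IsNoetherianRing A] [IsDomain A] {f : A} (hf : f ≠ 0) {d : ℕ} {x : Fin d → A}
    (hx : IsPBasis p x) {u : FA p A →ₗ[A] A} (hu : IsGenerator u) (n : ℕ) [NeZero n]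
    (hD : 0 ≤ (p : ℚ) • nsDivisor p f n) :
    IsQuasiFSplit p n (nsDivisor p f n) hD ↔
      ¬ nsIdeal hx u f n ≤ frobeniusPower p (IsLocalRing.maximalIdeal A) := by
  have := isIntegrallyClosed_of_isPBasis hx
  obtain ⟨m, rfl⟩ := Nat.exists_eq_succ_of_ne_zero (NeZero.ne n)
  exact (isQuasiFSplit_iff_exists_isDual hf hD).trans (exists_isDual_iff hf hx hu)

end QuasiFSplit

end

theorem theorem3p3 {p : ℕ} [Fact p.Prime] {A : Type*} [CommRing A] [CharP A p]
    [IsRegularLocalRing A] (hF : (frobenius A p).Finite)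
    (f : A) (hf : f ≠ 0)
    {d : ℕ} (x : Fin d → A) (hx : QuasiFSplit.IsPBasis p x)
    (u : QuasiFSplit.FA p A →ₗ[A] A) (hu : QuasiFSplit.IsGenerator u) :
    QuasiFSplit.nonSplittingIndex p f =
      sInf {N : ℕ∞ | ∃ n : ℕ+, N = ((n : ℕ) : ℕ∞) ∧
        QuasiFSplit.nsIdeal hx u f (n : ℕ) ≤
          QuasiFSplit.frobeniusPower p (IsLocalRing.maximalIdeal A)} := by
  have := QuasiFSplit.isDomain_of_isRegularLocalRing A
  refine congrArg sInf (Set.ext fun N => exists_congr fun n => and_congr_right fun _ => ?_)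
  rw [QuasiFSplit.isQuasiFSplit_nsDivisor_iff hf hx hu, not_not]
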